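/- Let $\mathcal K$ be a simplicial complex on $[m]=\{1,\dots,m\}$, with $\varnothing\in\mathcal K$ (subsets $\{i\}\notin\mathcal K$ are allowed). For $I\subset[m]$ let $\mathcal K_I=\{L\in\mathcal K: L\subset I\}$, let $C^p(\mathcal K_I)$, $p\ge -1$, be its augmented simplicial cochain groups over $\mathbb Z$ with coboundary $d$ (simplices oriented by the order of $[m]$), and let $\widetilde H^p(\mathcal K_I)$ be their cohomology. Put $\varepsilon(j,I)=(-1)^{\#\{i\in I:\, i<j\}}$. All bicomplexes are bigraded abelian groups with differentials $d$, $d'$ of bidegrees $(1,0)$, $(1,-2)$, $d^2=d'^2=0$, $dd'=-d'd$. (i) On $\bigoplus_{I\subset[m]}C^*(\mathcal K_I)$, where $C^{q-1}(\mathcal K_I)$ has bidegree $(q-|I|,2|I|)$, $d$ is the coboundary, and $d'=(-1)^{p+1}\sum_{i\in I}\varepsilon(i,I)\psi_{p;i,I}$ on $C^p(\mathcal K_I)$, where $\psi_{p;i,I}\colon C^p(\mathcal K_I)\to C^p(\mathcal K_{I\setminus\{i\}})$ is the restriction. (ii) On the Koszul algebra $\Lambda[u_1,\dots,u_m]\otimes\mathbb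 Z[\mathcal K]$, where $\mathbb Z[\mathcal K]=\mathbb Z[v_1,\dots,v_m]/(\prod_{i\in I}v_i: I\notin\mathcal K)$, with $\operatorname{bideg}u_i=(-1,2)$ and $\operatorname{bideg}v_i=(0,2)$, $d$ and $d'$ are the graded derivations with $du_i=v_i$, $dv_i=0$ and $d'u_i=1$, $d'v_i=0$. (iii) $R^*(\mathcal K)=\Lambda[u_1,\dots,u_m]\otimes\mathbb Z[\mathcal K]/(v_i^2=u_iv_i=0,\ 1\le i\le m)$ has the induced bigrading and differential $d$. The quotient map restricts to an isomorphism onto $R^*(\mathcal K)$ from the subgroup of the Koszul algebra spanned by the monomials $u_Jv_I=\prod_{j\in J}u_j\prod_{i\in I}v_i$ with $J\cap I=\varnothing$; this subgroup is $d'$-invariant, and $d'$ on $R^*(\mathcal K)$ is carried over from it. Let $\mathit{HH}^*(\mathcal Z_{\mathcal K})$ be the double cohomology of the moment-angle complex $\mathcal Z_{\mathcal K}$, that is, the cohomology of $H^*(\mathcal Z_{\mathcal K})=\bigoplus_{I\subset[m]}\widetilde H^*(\mathcal K_I)$ (Hochster decomposition, $H^{-k,2\ell}(\mathcal Z_{\mathcal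 K})=\bigoplus_{|I|=\ell}\widetilde H^{\ell-k-1}(\mathcal K_I)$) with respect to the differential $d'=(-1)^{p+1}\sum_{i\in I}\varepsilon(i,I)\psi_{p;i,I}$ on $\widetilde H^p(\mathcal K_I)$, where now $\psi_{p;i,I}\colon\widetilde H^p(\mathcal K_I)\to\widetilde H^p(\mathcal K_{I\setminus\{i\}})$ is induced by the inclusion $\mathcal K_{I\setminus\{i\}}\subset\mathcal K_I$. Theorem. The bicomplexes $\bigl(\bigoplus_{I\subset[m]}C^*(\mathcal K_I),d,d'\bigr)$ and $(R^*(\mathcal K),d,d')$ are isomorphic. Moreover, there is an isomorphism of bigraded abelian groups $$\mathit{HH}^*(\mathcal Z_{\mathcal K})\cong H\bigl(H(\Lambda[u_1,\dots,u_m]\otimes\mathbb Z[\mathcal K],d),d'\bigr)$$ between the double cohomology and the first double cohomology of the Koszul bicomplex. -/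

import Mathlib

section Homology

variable {k : Type} [CommRing k] {X Y : Type} [AddCommGroup X] [Module k X]
  [AddCommGroup Y] [Module k Y]

/-- The cohomology `ker d / im d` of a module with an endomorphism `d` such that `d ∘ d = 0`. -/
abbrev Cohomology (d : X →ₗ[k] X) (_hd : d ∘ₗ d = 0) : Type :=
  LinearMap.ker d ⧸ (LinearMap.range d).submoduleOf (LinearMap.ker d)

/-- The map induced on cohomology by a linear map that takes cocycles to cocycles and coboundaries
to coboundaries (for instance a map commuting, or anticommuting, with the differentials). -/
def Cohomology.map {dX : X →ₗ[k] X} {hX : dX ∘ₗ dX = 0} {dY : Y →ₗ[k] Y} {hY : dY ∘ₗ dY = 0}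
    (φ : X →ₗ[k] Y) (hker : ∀ x, dX x = 0 → dY (φ x) = 0)
    (hrange : ∀ x, ∃ y, dY y = φ (dX x)) : Cohomology dX hX →ₗ[k] Cohomology dY hY :=
  Submodule.mapQ _ _
    (φ.restrict (p := LinearMap.ker dX) (q := LinearMap.ker dY) fun x hx => hker x hx) <| by
    rintro ⟨x, hx⟩ ⟨z, hz⟩
    obtain ⟨y, hy⟩ := hrange z
    exact ⟨y, hy.trans (congrArg φ hz)⟩

/-- The classes of the cocycles lying in the submodule `G`; if `G` is a graded component of `X`,
this is the corresponding graded component of the cohomology. -/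
def Cohomology.part (d : X →ₗ[k] X) (hd : d ∘ₗ d = 0) (G : Submodule k X) :
    Submodule k (Cohomology d hd) :=
  (G.submoduleOf (LinearMap.ker d)).map (Submodule.mkQ _)

end Homology

/-- A bicomplex: a bigraded module with differentials `d` and `d'` of bidegrees `(1, 0)` and
`(1, -2)` such that `d d' = - d' d`. -/
structure Bicomplex (k : Type) [CommRing k] where
  X : Type
  [addCommGroup : AddCommGroup X]
  [module : Module k X]
  gr : ℤ × ℤ → Submodule k X
  isInternal : DirectSum.IsInternal gr
  d : X →ₗ[k] X
  d' : X →ₗ[k] X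
  d_mem : ∀ p, ∀ x ∈ gr p, d x ∈ gr (p + (1, 0))
  d'_mem : ∀ p, ∀ x ∈ gr p, d' x ∈ gr (p + (1, -2))
  d_comp_d : d ∘ₗ d = 0
  d'_comp_d' : d' ∘ₗ d' = 0
  anticomm : d ∘ₗ d' = - (d' ∘ₗ d)

namespace Bicomplex

variable {k : Type} [CommRing k]

attribute [instance] Bicomplex.addCommGroup Bicomplex.module

/-- An isomorphism of bicomplexes: a linear bijection that respects the bigradings and commutes
with both differentials. -/
structure Iso (A B : Bicomplex k) where
  toEquiv : A.X ≃ₗ[k] B.X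
  map_gr : ∀ p, (A.gr p).map toEquiv.toLinearMap = B.gr p
  comm_d : ∀ x, toEquiv (A.d x) = B.d (toEquiv x)
  comm_d' : ∀ x, toEquiv (A.d' x) = B.d' (toEquiv x)

variable (B : Bicomplex k)

/-- `H(X, d)`. -/
abbrev H : Type := Cohomology B.d B.d_comp_d

/-- The differential induced by `d'` on `H(X, d)`. -/
def dH : B.H →ₗ[k] B.H :=
  Cohomology.map B.d'
    (fun x hx => by
      have h := LinearMap.congr_fun B.anticomm x
      simp only [LinearMap.comp_apply, LinearMap.neg_apply] at h
      rw [h, hx, map_zero, neg_zero])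
    (fun x => ⟨- B.d' x, by
      have h := LinearMap.congr_fun B.anticomm x
      simp only [LinearMap.comp_apply, LinearMap.neg_apply] at h
      rw [map_neg, h, neg_neg]⟩)

theorem dH_comp_dH : B.dH ∘ₗ B.dH = 0 := by
  refine LinearMap.ext fun x => ?_
  obtain ⟨⟨x, hx⟩, rfl⟩ := Submodule.mkQ_surjective _ x
  have h := LinearMap.congr_fun B.d'_comp_d' x
  refine (Submodule.Quotient.mk_eq_zero _).2 ?_
  change B.d' (B.d' x) ∈ LinearMap.range B.d
  rw [show B.d' (B.d' x) = 0 from h]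
  exact zero_mem _

/-- The first double cohomology `H(H(X, d), d')`. -/
abbrev FirstDoubleCohomology : Type := Cohomology B.dH B.dH_comp_dH

/-- The bigraded components of the first double cohomology. -/
def firstDoubleCohomologyGr (p : ℤ × ℤ) : Submodule k B.FirstDoubleCohomology :=
  Cohomology.part B.dH B.dH_comp_dH (Cohomology.part B.d B.d_comp_d (B.gr p))

end Bicomplex

section Signs

variable {m : ℕ}

/-- `ε(j, I) = (-1) ^ #{i ∈ I | i < j}`. -/
def eps (k : Type) [CommRing k] (j : Fin m) (I : Finset (Fin m)) : k :=
  (-1) ^ (I.filter (· < j)).card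

variable {k : Type} [CommRing k]

theorem eps_erase_self (j : Fin m) (I : Finset (Fin m)) : eps k j (I.erase j) = eps k j I := by
  unfold eps
  congr 2
  ext i
  simp only [Finset.mem_filter, Finset.mem_erase]
  grind

theorem eps_insert_self (j : Fin m) (I : Finset (Fin m)) : eps k j (insert j I) = eps k j I := by
  unfold eps
  congr 2
  ext i
  simp only [Finset.mem_filter, Finset.mem_insert]
  grind

theorem eps_insert {i j : Fin m} {I : Finset (Fin m)} (hi : i ∉ I) :
    eps k j (insert i I) = (if i < j then -1 else 1) * eps k j I := by
  unfold eps
  rw [Finset.filter_insert]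
  split_ifs with h
  · rw [Finset.card_insert_of_notMem (by simp [hi]), pow_succ, mul_comm]
  · rw [one_mul]

theorem eps_insert_mul {i j : Fin m} {I : Finset (Fin m)} (hi : i ∉ I) (hj : j ∉ I) (h : i ≠ j) :
    eps k i I * eps k j (insert i I) = - (eps k j I * eps k i (insert j I)) := by
  rw [eps_insert hi, eps_insert hj]
  rcases lt_or_gt_of_ne h with h | h
  · rw [if_pos h, if_neg h.not_gt]; ring
  · rw [if_pos h, if_neg h.not_gt]; ring

theorem sum_antisymm {A : Type} [AddCommGroup A] (s : Finset (Fin m)) (g : Fin m → Fin m → A)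
    (hg : ∀ i ∈ s, ∀ j ∈ s, i ≠ j → g i j = - g j i) :
    ∑ i ∈ s, ∑ j ∈ s.erase i, g i j = 0 := by
  rw [Finset.sum_sigma']
  refine Finset.sum_involution (fun x _ => ⟨x.2, x.1⟩) ?_ ?_ ?_ ?_
  · rintro ⟨i, j⟩ h
    simp only [Finset.mem_sigma, Finset.mem_erase] at h
    rw [hg i h.1 j h.2.2 (Ne.symm h.2.1)]
    simp
  · rintro ⟨i, j⟩ h _ h'
    simp only [Finset.mem_sigma, Finset.mem_erase] at h
    simp only [Sigma.mk.injEq] at h'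
    exact h.2.1 h'.1
  · rintro ⟨i, j⟩ h
    simp only [Finset.mem_sigma, Finset.mem_erase] at h ⊢
    exact ⟨h.2.2, Ne.symm h.2.1, h.1⟩
  · rintro ⟨i, j⟩ _
    rfl

end Signs

section Simplicial

variable {m : ℕ}

/-- The simplices of `K`, including the empty simplex. -/
def IsSimplex (K : PreAbstractSimplicialComplex (Fin m)) (L : Finset (Fin m)) : Prop :=
  L = ∅ ∨ L ∈ K.faces

theorem IsSimplex.mono {K : PreAbstractSimplicialComplex (Fin m)} {L M : Finset (Fin m)}
    (hM : IsSimplex K M) (h : L ⊆ M) : IsSimplex K L := by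
  rcases L.eq_empty_or_nonempty with hL | hL
  · exact Or.inl hL
  · rcases hM with rfl | hM
    · exact Or.inl (Finset.subset_empty.1 h)
    · exact Or.inr ((K.isRelLowerSet_faces hM).2 h hL)

/-- The full subcomplex `K_I` of `K` on the vertices in `I`. -/
def fullSubcomplex (K : PreAbstractSimplicialComplex (Fin m)) (I : Finset (Fin m)) :
    PreAbstractSimplicialComplex (Fin m) where
  faces := {L | L ∈ K.faces ∧ L ⊆ I}
  isRelLowerSet_faces := fun _ h =>
    ⟨(K.isRelLowerSet_faces h.1).1, fun _ hM hne =>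
      ⟨(K.isRelLowerSet_faces h.1).2 hM hne, hM.trans h.2⟩⟩

theorem fullSubcomplex_mono (K : PreAbstractSimplicialComplex (Fin m)) {I J : Finset (Fin m)}
    (h : I ⊆ J) : fullSubcomplex K I ≤ fullSubcomplex K J :=
  fun _ hL => ⟨hL.1, hL.2.trans h⟩

theorem IsSimplex.of_le {K L : PreAbstractSimplicialComplex (Fin m)} (h : K ≤ L)
    {M : Finset (Fin m)} (hM : IsSimplex K M) : IsSimplex L M :=
  hM.imp id fun hM => h hM

variable (k : Type)

/-- The (augmented) simplicial cochains of `K`, of all degrees: functions on the simplices of `K`,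
each simplex being oriented by the order of its vertices; the empty simplex has degree `-1`. -/
abbrev Cochain (K : PreAbstractSimplicialComplex (Fin m)) : Type :=
  {L : Finset (Fin m) // IsSimplex K L} → k

variable [CommRing k]

/-- The cochains of degree `p`: those supported on the simplices with `p + 1` vertices. -/
def cochainDegree (K : PreAbstractSimplicialComplex (Fin m)) (p : ℤ) :
    Submodule k (Cochain k K) where
  carrier := {f | ∀ L, (L.1.card : ℤ) ≠ p + 1 → f L = 0}
  add_mem' hf hg L hL := by rw [Pi.add_apply, hf L hL, hg L hL, add_zero]
  zero_mem' _ _ := rfl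
  smul_mem' c f hf L hL := by rw [Pi.smul_apply, hf L hL, smul_zero]

/-- The simplicial coboundary. -/
def coboundary (K : PreAbstractSimplicialComplex (Fin m)) : Cochain k K →ₗ[k] Cochain k K where
  toFun f M := ∑ j ∈ M.1, eps k j (M.1.erase j) *
    f ⟨M.1.erase j, M.2.mono (Finset.erase_subset j M.1)⟩
  map_add' f g := by
    ext M
    simp [mul_add, Finset.sum_add_distrib]
  map_smul' c f := by
    ext M
    simp [Finset.mul_sum, mul_left_comm]

theorem coboundary_comp (K : PreAbstractSimplicialComplex (Fin m)) :
    coboundary k K ∘ₗ coboundary k K = 0 := by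
  refine LinearMap.ext fun f => funext fun M => ?_
  simp only [LinearMap.comp_apply, coboundary, LinearMap.coe_mk, AddHom.coe_mk, Finset.mul_sum,
    LinearMap.zero_apply, Pi.zero_apply]
  refine sum_antisymm M.1 (fun i j => eps k i (M.1.erase i) *
    (eps k j ((M.1.erase i).erase j) * f ⟨(M.1.erase i).erase j, _⟩)) ?_
  intro i hi j hj hij
  have e1 : M.1.erase i = insert j ((M.1.erase i).erase j) :=
    (Finset.insert_erase (Finset.mem_erase.2 ⟨hij.symm, hj⟩)).symm
  have e2 : M.1.erase j = insert i ((M.1.erase i).erase j) := by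
    rw [Finset.erase_right_comm]
    exact (Finset.insert_erase (Finset.mem_erase.2 ⟨hij, hi⟩)).symm
  have h := eps_insert_mul (k := k) (I := (M.1.erase i).erase j) (i := i) (j := j)
    (by simp) (by simp) hij
  simp only [Finset.erase_right_comm (a := j) (b := i)]
  rw [← mul_assoc, ← mul_assoc, ← neg_mul]
  congr 1
  rw [← e1, ← e2] at h
  linear_combination h

variable {k} in
/-- Restriction of cochains along the inclusion of a subcomplex. -/
def cochainRestrict {K L : PreAbstractSimplicialComplex (Fin m)} (h : K ≤ L) :
    Cochain k L →ₗ[k] Cochain k K :=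
  LinearMap.funLeft k k fun M => ⟨M.1, M.2.of_le h⟩

/-- Multiplication by `(-1) ^ (p + 1)` on the cochains of degree `p`. -/
def cochainSign (K : PreAbstractSimplicialComplex (Fin m)) : Cochain k K →ₗ[k] Cochain k K where
  toFun f L := (-1) ^ L.1.card * f L
  map_add' f g := by
    ext L
    simp [mul_add]
  map_smul' c f := by
    ext L
    simp [mul_left_comm]

theorem coboundary_restrict {K L : PreAbstractSimplicialComplex (Fin m)} (h : K ≤ L)
    (f : Cochain k L) :
    coboundary k K (cochainRestrict h f) = cochainRestrict h (coboundary k L f) := rfl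

theorem coboundary_sign (K : PreAbstractSimplicialComplex (Fin m)) (f : Cochain k K) :
    coboundary k K (cochainSign k K f) = - cochainSign k K (coboundary k K f) := by
  funext M
  simp only [coboundary, cochainSign, LinearMap.coe_mk, AddHom.coe_mk, Pi.neg_apply,
    Finset.mul_sum, ← Finset.sum_neg_distrib]
  refine Finset.sum_congr rfl fun j hj => ?_
  rw [← Finset.card_erase_add_one hj, pow_succ]
  ring

theorem sign_restrict {K L : PreAbstractSimplicialComplex (Fin m)} (h : K ≤ L)
    (f : Cochain k L) :
    cochainSign k K (cochainRestrict h f) = cochainRestrict h (cochainSign k L f) := rfl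

theorem sign_sign (K : PreAbstractSimplicialComplex (Fin m)) (f : Cochain k K) :
    cochainSign k K (cochainSign k K f) = f := by
  funext L
  simp only [cochainSign, LinearMap.coe_mk, AddHom.coe_mk]
  rw [← mul_assoc, ← mul_pow]
  simp

/-- The reduced simplicial cohomology of `K`, in all degrees. -/
abbrev ReducedCohomology (K : PreAbstractSimplicialComplex (Fin m)) : Type :=
  Cohomology (coboundary k K) (coboundary_comp k K)

/-- The reduced simplicial cohomology of `K` in degree `p`. -/
def reducedCohomologyDegree (K : PreAbstractSimplicialComplex (Fin m)) (p : ℤ) :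
    Submodule k (ReducedCohomology k K) :=
  Cohomology.part (coboundary k K) (coboundary_comp k K) (cochainDegree k K p)

/-- The map induced on reduced cohomology by the inclusion of a subcomplex. -/
def cohomologyRestrict {K L : PreAbstractSimplicialComplex (Fin m)} (h : K ≤ L) :
    ReducedCohomology k L →ₗ[k] ReducedCohomology k K :=
  Cohomology.map (cochainRestrict h)
    (fun f hf => by rw [coboundary_restrict, hf, map_zero])
    (fun f => ⟨cochainRestrict h f, rfl⟩)

/-- Multiplication by `(-1) ^ (p + 1)` on the reduced cohomology in degree `p`. -/
def cohomologySign (K : PreAbstractSimplicialComplex (Fin m)) :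
    ReducedCohomology k K →ₗ[k] ReducedCohomology k K :=
  Cohomology.map (cochainSign k K)
    (fun f hf => by rw [coboundary_sign, hf, map_zero, neg_zero])
    (fun f => ⟨- cochainSign k K f, by rw [map_neg, coboundary_sign, neg_neg]⟩)

end Simplicial

section Internal

variable {k : Type} [CommRing k] {X ι : Type} [AddCommGroup X] [Module k X]

theorem isInternal_of_basis (b : Module.Basis ι k X) (deg : ι → ℤ × ℤ)
    (gr : ℤ × ℤ → Submodule k X)
    (hgr : ∀ p, gr p = Submodule.span k (b '' {i | deg i = p})) : DirectSum.IsInternal gr := by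
  obtain rfl : gr = fun p => Submodule.span k (b '' {i | deg i = p}) := funext hgr
  refine DirectSum.isInternal_submodule_of_iSupIndep_of_iSup_eq_top ?_ ?_
  · rw [iSupIndep_def]
    intro p
    have h : (⨆ q, ⨆ (_ : q ≠ p), Submodule.span k (b '' {i | deg i = q})) ≤
        Submodule.span k (b '' {i | deg i ≠ p}) := by
      refine iSup₂_le fun q hq => Submodule.span_mono (Set.image_mono ?_)
      intro i hi
      simp only [Set.mem_ofPred_eq] at hi ⊢
      rw [hi]; exact hq
    refine Disjoint.mono_right h ?_
    rcases subsingleton_or_nontrivial k with hk | hk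
    · have := Module.subsingleton k X
      rw [disjoint_iff]
      exact Subsingleton.elim _ _
    · refine b.linearIndependent.disjoint_span_image ?_
      rw [Set.disjoint_left]
      intro i hi hi'
      exact hi' hi
  · rw [eq_top_iff, ← b.span_eq, Submodule.span_le]
    rintro _ ⟨i, rfl⟩
    exact Submodule.mem_iSup_of_mem (deg i) (Submodule.subset_span ⟨i, rfl, rfl⟩)

theorem span_image_eq_of_mem_iff (b : Module.Basis ι k X) (s : Set ι) (G : Submodule k X)
    (h : ∀ x, x ∈ G ↔ ∀ i, i ∉ s → b.repr x i = 0) : G = Submodule.span k (b '' s) := by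
  ext x
  rw [h, Module.Basis.mem_span_image]
  constructor
  · intro hx i hi
    by_contra his
    exact (Finsupp.mem_support_iff.1 hi) (hx i his)
  · intro hx i hi
    by_contra hne
    exact hi (hx (Finsupp.mem_support_iff.2 hne))

end Internal

section CochainBicomplex

variable {m : ℕ} (k : Type) (K : PreAbstractSimplicialComplex (Fin m))

/-- The direct sum of the cochain groups `C^*(K_I)` over all subsets `I` of the vertex set. -/
abbrev TotalCochain : Type := (I : Finset (Fin m)) → Cochain k (fullSubcomplex K I)

theorem totalCochain_congr (x : TotalCochain k K) {I J : Finset (Fin m)} (h : I = J)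
    (L : Finset (Fin m)) (hI : IsSimplex (fullSubcomplex K I) L)
    (hJ : IsSimplex (fullSubcomplex K J) L) : x I ⟨L, hI⟩ = x J ⟨L, hJ⟩ := by
  subst h; rfl

variable [CommRing k]

/-- The component of bidegree `(a, b)`: the sum of `C^p(K_I)` over `I` with `2 * #I = b`, where
`p = a + #I - 1`. Thus `C^(q - 1)(K_I)` has bidegree `(q - #I, 2 * #I)`. -/
def totalCochainGr (ab : ℤ × ℤ) : Submodule k (TotalCochain k K) :=
  Submodule.pi Set.univ fun I =>
    if ab.2 = 2 * I.card then cochainDegree k (fullSubcomplex K I) (ab.1 + I.card - 1) else ⊥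

/-- The simplicial coboundary on each `C^*(K_I)`. -/
def totalCochainD : TotalCochain k K →ₗ[k] TotalCochain k K :=
  LinearMap.pi fun I => coboundary k (fullSubcomplex K I) ∘ₗ LinearMap.proj I

/-- The differential given on `C^p(K_J)` by `(-1) ^ (p + 1) * ∑ i ∈ J, ε(i, J) ψ_i`, where
`ψ_i : C^p(K_J) → C^p(K_(J \ {i}))` is the restriction. The component of the result at `I` is the
sum of the contributions of the `J = I ∪ {i}` with `i ∉ I`. -/
def totalCochainD' : TotalCochain k K →ₗ[k] TotalCochain k K :=
  LinearMap.pi fun I => ∑ i ∈ Iᶜ, eps k i (insert i I) •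
    (cochainRestrict (fullSubcomplex_mono K (Finset.subset_insert i I)) ∘ₗ
      cochainSign k (fullSubcomplex K (insert i I)) ∘ₗ LinearMap.proj (insert i I))

theorem totalCochainD'_apply (x : TotalCochain k K) (I : Finset (Fin m))
    (L : {L // IsSimplex (fullSubcomplex K I) L}) :
    totalCochainD' k K x I L = ∑ i ∈ Iᶜ, eps k i (insert i I) * ((-1) ^ L.1.card *
      x (insert i I)
        ⟨L.1, L.2.of_le (fullSubcomplex_mono K (Finset.subset_insert i I))⟩) := by
  simp [totalCochainD', cochainRestrict, cochainSign, LinearMap.funLeft]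

theorem totalCochainD'_comp : totalCochainD' k K ∘ₗ totalCochainD' k K = 0 := by
  refine LinearMap.ext fun x => funext fun I => funext fun L => ?_
  simp only [LinearMap.comp_apply, totalCochainD'_apply, LinearMap.zero_apply, Pi.zero_apply,
    Finset.mul_sum, Finset.compl_insert]
  refine sum_antisymm Iᶜ (fun i j => eps k i (insert i I) * ((-1) ^ L.1.card *
    (eps k j (insert j (insert i I)) * ((-1) ^ L.1.card * x (insert j (insert i I))
      ⟨L.1, L.2.of_le (fullSubcomplex_mono K ((Finset.subset_insert i I).trans
        (Finset.subset_insert j _)))⟩)))) ?_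
  intro i hi j hj hij
  have h := eps_insert_mul (k := k) (Finset.mem_compl.1 hi) (Finset.mem_compl.1 hj) hij
  simp only [eps_insert_self]
  rw [totalCochain_congr k K x (Finset.insert_comm i j I) L.1 _
    (L.2.of_le (fullSubcomplex_mono K ((Finset.subset_insert i I).trans
        (Finset.subset_insert j _))))]
  linear_combination ((-1) ^ L.1.card * ((-1) ^ L.1.card * x (insert j (insert i I))
      ⟨L.1, L.2.of_le (fullSubcomplex_mono K ((Finset.subset_insert i I).trans
        (Finset.subset_insert j _)))⟩)) * h

theorem totalCochain_anticomm :
    totalCochainD k K ∘ₗ totalCochainD' k K = - (totalCochainD' k K ∘ₗ totalCochainD k K) := by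
  refine LinearMap.ext fun x => funext fun I => ?_
  simp only [totalCochainD, totalCochainD', LinearMap.comp_apply, LinearMap.pi_apply,
    LinearMap.proj_apply, LinearMap.sum_apply, LinearMap.smul_apply, map_sum, map_smul,
    LinearMap.neg_apply, Pi.neg_apply, coboundary_restrict, coboundary_sign, map_neg, smul_neg,
    Finset.sum_neg_distrib]

theorem cochainRestrict_mem {K L : PreAbstractSimplicialComplex (Fin m)} (h : K ≤ L) {p : ℤ}
    {f : Cochain k L} (hf : f ∈ cochainDegree k L p) :
    cochainRestrict h f ∈ cochainDegree k K p := fun M hM => hf ⟨M.1, M.2.of_le h⟩ hM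

theorem cochainSign_mem (K : PreAbstractSimplicialComplex (Fin m)) {p : ℤ}
    {f : Cochain k K} (hf : f ∈ cochainDegree k K p) :
    cochainSign k K f ∈ cochainDegree k K p := fun M hM => by
  simp [cochainSign, hf M hM]

theorem coboundary_mem (K : PreAbstractSimplicialComplex (Fin m)) {p : ℤ}
    {f : Cochain k K} (hf : f ∈ cochainDegree k K p) :
    coboundary k K f ∈ cochainDegree k K (p + 1) := fun M hM => by
  simp only [coboundary, LinearMap.coe_mk, AddHom.coe_mk]
  refine Finset.sum_eq_zero fun j hj => ?_
  rw [hf, mul_zero]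
  have := Finset.card_erase_add_one hj
  simp only
  omega

/-- The bicomplex `⊕_I C^*(K_I)`. -/
noncomputable def cochainBicomplex : Bicomplex k where
  X := TotalCochain k K
  gr := totalCochainGr k K
  d := totalCochainD k K
  d' := totalCochainD' k K
  isInternal := by
    classical
    refine isInternal_of_basis (Pi.basis fun I => Pi.basisFun k _)
      (fun s : (I : Finset (Fin m)) × {L // IsSimplex (fullSubcomplex K I) L} =>
        ((s.2.1.card - s.1.card, 2 * s.1.card) : ℤ × ℤ)) _ fun p => ?_
    refine span_image_eq_of_mem_iff _ _ _ fun x => ?_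
    simp only [totalCochainGr, Submodule.mem_pi, Set.mem_univ, true_implies, Sigma.forall,
      Pi.basis_repr, Pi.basisFun_repr, Set.mem_ofPred_eq]
    refine forall_congr' fun I => ?_
    split_ifs with h
    · refine forall_congr' fun L => imp_congr_left ?_
      rw [not_iff_not, Prod.ext_iff]
      constructor
      · intro h'; exact ⟨by simp only; omega, h.symm⟩
      · rintro ⟨h', -⟩; simp only at h'; omega
    · rw [Submodule.mem_bot]
      constructor
      · intro h0 L _; rw [h0]; rfl
      · intro h0; funext L
        refine h0 L fun h' => h ?_
        rw [← h']
  d_mem := by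
    rintro ⟨a, b⟩ x hx I hI
    have hx := hx I hI
    simp only [add_zero, Prod.mk_add_mk] at hx ⊢
    split_ifs at hx ⊢ with h
    · have := coboundary_mem k _ hx
      rw [show a + I.card - 1 + 1 = a + 1 + I.card - 1 by ring] at this
      exact this
    · have hx : x I = 0 := hx
      refine (Submodule.mem_bot k).2 ?_
      simp [totalCochainD, hx]
  d'_mem := by
    rintro ⟨a, b⟩ x hx I hI
    simp only [Prod.mk_add_mk, totalCochainD', LinearMap.pi_apply, LinearMap.sum_apply]
    refine Submodule.sum_mem _ fun i hi => ?_
    have hc := Finset.card_insert_of_notMem (Finset.mem_compl.1 hi)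
    have hx := hx (insert i I) trivial
    simp only at hx
    refine Submodule.smul_mem _ _ ?_
    simp only [LinearMap.comp_apply, LinearMap.proj_apply]
    split_ifs at hx ⊢ with h h' h'
    · have := cochainRestrict_mem k (fullSubcomplex_mono K (Finset.subset_insert i I))
        (cochainSign_mem k _ hx)
      rw [hc, show a + ((I.card + 1 : ℕ) : ℤ) - 1 = a + 1 + I.card - 1 by push_cast; ring] at this
      exact this
    · omega
    · omega
    · have hx : x (insert i I) = 0 := hx
      rw [hx, map_zero, map_zero]
      exact zero_mem _
  d_comp_d := by
    refine LinearMap.ext fun x => funext fun I => ?_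
    exact LinearMap.congr_fun (coboundary_comp k (fullSubcomplex K I)) (x I)
  d'_comp_d' := totalCochainD'_comp k K
  anticomm := totalCochain_anticomm k K

end CochainBicomplex

section DoubleCohomology

variable {m : ℕ} (k : Type) [CommRing k] (K : PreAbstractSimplicialComplex (Fin m))

/-- The cohomology of the moment-angle complex of `K`, written through its Hochster decomposition
as the direct sum of the reduced cohomology groups of the full subcomplexes `K_I`. -/
abbrev HochsterCohomology : Type :=
  (I : Finset (Fin m)) → ReducedCohomology k (fullSubcomplex K I)

/-- The component of bidegree `(a, b)`; in bidegree `(-i, 2 * l)` it is the sum of the reduced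
cohomology groups of degree `l - i - 1` of the `K_I` with `#I = l`. -/
def hochsterCohomologyGr (ab : ℤ × ℤ) : Submodule k (HochsterCohomology k K) :=
  Submodule.pi Set.univ fun I =>
    if ab.2 = 2 * I.card then
      reducedCohomologyDegree k (fullSubcomplex K I) (ab.1 + I.card - 1) else ⊥

/-- The differential `d'` on the cohomology of the moment-angle complex, given on the summand of
degree `p` of `K_J` by `(-1) ^ (p + 1) * ∑ i ∈ J, ε(i, J) ψ_i`, where `ψ_i` is induced in reduced
cohomology by the inclusion of `K_(J \ {i})` in `K_J`. -/
def hochsterD' : HochsterCohomology k K →ₗ[k] HochsterCohomology k K :=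
  LinearMap.pi fun I => ∑ i ∈ Iᶜ, eps k i (insert i I) •
    (cohomologyRestrict k (fullSubcomplex_mono K (Finset.subset_insert i I)) ∘ₗ
      cohomologySign k (fullSubcomplex K (insert i I)) ∘ₗ LinearMap.proj (insert i I))

theorem hochsterD'_comp : hochsterD' k K ∘ₗ hochsterD' k K = 0 := by
  -- the family of classes of a family of cocycles
  let Z := (I : Finset (Fin m)) → LinearMap.ker (coboundary k (fullSubcomplex K I))
  let q : Z →ₗ[k] HochsterCohomology k K :=
    LinearMap.pi fun I => Submodule.mkQ _ ∘ₗ LinearMap.proj I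
  have hker : ∀ (z : Z) I, coboundary k _ (totalCochainD' k K (fun I => (z I).1) I) = 0 := by
    intro z I
    have h := congrFun (LinearMap.congr_fun (totalCochain_anticomm k K) fun I => (z I).1) I
    have h0 : totalCochainD k K (fun I => (z I).1) = 0 := funext fun I => (z I).2
    simp only [LinearMap.comp_apply, LinearMap.neg_apply, h0, map_zero, neg_zero] at h
    exact h
  let D (z : Z) : Z := fun I => ⟨totalCochainD' k K (fun I => (z I).1) I, hker z I⟩
  have hq : ∀ z, hochsterD' k K (q z) = q (D z) := by
    intro z
    funext I
    have : D z I = ∑ i ∈ (Iᶜ).attach, eps k i.1 (insert i.1 I) •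
        (⟨cochainRestrict (fullSubcomplex_mono K (Finset.subset_insert i.1 I))
          (cochainSign k _ (z (insert i.1 I)).1), by
          rw [LinearMap.mem_ker, coboundary_restrict, coboundary_sign, (z (insert i.1 I)).2,
            map_zero, neg_zero, map_zero]⟩ :
          LinearMap.ker (coboundary k (fullSubcomplex K I))) := by
      refine Subtype.ext ?_
      rw [AddSubmonoidClass.coe_finsetSum]
      simp only [D, totalCochainD', LinearMap.pi_apply, LinearMap.sum_apply]
      rw [← Finset.sum_attach]
      rfl
    change _ = Submodule.mkQ _ (D z I)
    rw [this, map_sum]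
    simp only [hochsterD', LinearMap.pi_apply, LinearMap.sum_apply]
    rw [← Finset.sum_attach]
    rfl
  refine LinearMap.ext fun x => ?_
  have hsurj : Function.Surjective q := fun y =>
    ⟨fun I => (Submodule.mkQ_surjective _ (y I)).choose,
      funext fun I => (Submodule.mkQ_surjective _ (y I)).choose_spec⟩
  obtain ⟨z, rfl⟩ := hsurj x
  rw [LinearMap.comp_apply, hq, hq]
  have : D (D z) = 0 := funext fun I => Subtype.ext <|
    congrFun (LinearMap.congr_fun (totalCochainD'_comp k K) fun I => (z I).1) I
  rw [this, map_zero]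
  rfl

/-- The double cohomology of the moment-angle complex of `K`. -/
abbrev DoubleCohomology : Type := Cohomology (hochsterD' k K) (hochsterD'_comp k K)

/-- The bigraded components of the double cohomology. -/
def doubleCohomologyGr (p : ℤ × ℤ) : Submodule k (DoubleCohomology k K) :=
  Cohomology.part (hochsterD' k K) (hochsterD'_comp k K) (hochsterCohomologyGr k K p)

end DoubleCohomology

section FaceRing

open MvPolynomial

variable {m : ℕ} (k : Type) [CommRing k] (K : PreAbstractSimplicialComplex (Fin m))

/-- The ideal generated by the monomials `∏ i ∈ I, v_i` for which `I` is not a simplex of `K`. -/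
noncomputable def stanleyReisnerIdeal : Ideal (MvPolynomial (Fin m) k) :=
  Ideal.span {f | ∃ I : Finset (Fin m), ¬ IsSimplex K I ∧ f = ∏ i ∈ I, X i}

/-- The face ring of `K`. -/
def FaceRing : Type := MvPolynomial (Fin m) k ⧸ stanleyReisnerIdeal k K

noncomputable instance : CommRing (FaceRing k K) :=
  inferInstanceAs (CommRing (MvPolynomial (Fin m) k ⧸ stanleyReisnerIdeal k K))

noncomputable instance : Algebra k (FaceRing k K) :=
  inferInstanceAs (Algebra k (MvPolynomial (Fin m) k ⧸ stanleyReisnerIdeal k K))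

/-- The quotient map from the polynomial ring to the face ring. -/
noncomputable def faceMk : MvPolynomial (Fin m) k →ₐ[k] FaceRing k K :=
  Ideal.Quotient.mkₐ k (stanleyReisnerIdeal k K)

theorem faceMk_surjective : Function.Surjective (faceMk k K) :=
  Ideal.Quotient.mkₐ_surjective k (stanleyReisnerIdeal k K)

theorem faceMk_eq_zero {f : MvPolynomial (Fin m) k} :
    faceMk k K f = 0 ↔ f ∈ stanleyReisnerIdeal k K :=
  Ideal.Quotient.eq_zero_iff_mem

theorem prod_X_eq_monomial (I : Finset (Fin m)) :
    (∏ i ∈ I, X i : MvPolynomial (Fin m) k) = monomial (∑ i ∈ I, Finsupp.single i 1) 1 := by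
  classical
  induction I using Finset.induction_on with
  | empty => simp
  | insert i I hi ih =>
    rw [Finset.prod_insert hi, Finset.sum_insert hi, ih, X, monomial_mul, one_mul]

/-- The exponent of a square-free monomial. -/
noncomputable def sqfree (I : Finset (Fin m)) : Fin m →₀ ℕ := ∑ i ∈ I, Finsupp.single i 1

theorem sqfree_apply (I : Finset (Fin m)) (j : Fin m) :
    sqfree I j = if j ∈ I then 1 else 0 := by
  simp [sqfree, Finsupp.finsetSum_apply, Finsupp.single_apply]

theorem sqfree_support (I : Finset (Fin m)) : (sqfree I).support = I := by
  ext j; simp [sqfree_apply]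

theorem sqfree_le (I : Finset (Fin m)) (a : Fin m →₀ ℕ) : sqfree I ≤ a ↔ I ⊆ a.support := by
  constructor
  · intro h j hj
    have := h j
    rw [sqfree_apply, if_pos hj] at this
    rw [Finsupp.mem_support_iff]; omega
  · intro h j
    rw [sqfree_apply]
    split_ifs with hj
    · have := Finsupp.mem_support_iff.1 (h hj); omega
    · exact Nat.zero_le _

theorem mem_stanleyReisnerIdeal (f : MvPolynomial (Fin m) k) :
    f ∈ stanleyReisnerIdeal k K ↔ ∀ a ∈ f.support, ¬ IsSimplex K a.support := by
  have : stanleyReisnerIdeal k K = Ideal.span ((fun s => monomial s (1 : k)) ''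
      (sqfree '' {I : Finset (Fin m) | ¬ IsSimplex K I})) := by
    unfold stanleyReisnerIdeal
    congr 1
    ext f
    simp only [Set.mem_ofPred_eq, Set.mem_image, exists_exists_and_eq_and, prod_X_eq_monomial]
    refine exists_congr fun I => and_congr_right fun _ => ?_
    exact eq_comm
  rw [this, mem_ideal_span_monomial_image]
  refine forall₂_congr fun a _ => ?_
  constructor
  · rintro ⟨_, ⟨I, hI, rfl⟩, hle⟩ ha
    exact hI (ha.mono ((sqfree_le I a).1 hle))
  · intro ha
    exact ⟨_, ⟨a.support, ha, rfl⟩, (sqfree_le _ a).2 subset_rfl⟩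

/-- The class of a monomial in the face ring. -/
noncomputable def faceMonomial (a : Fin m →₀ ℕ) : FaceRing k K :=
  faceMk k K (monomial a 1)

theorem faceMonomial_eq_zero {a : Fin m →₀ ℕ} (h : ¬ IsSimplex K a.support) :
    faceMonomial k K a = 0 := by
  refine (faceMk_eq_zero k K).2 ((mem_stanleyReisnerIdeal k K _).2 fun b hb => ?_)
  rwa [Finset.mem_singleton.1 (support_monomial_subset hb)]

theorem faceMonomial_mul (a b : Fin m →₀ ℕ) :
    faceMonomial k K a * faceMonomial k K b = faceMonomial k K (a + b) := by
  rw [faceMonomial, faceMonomial, ← map_mul, monomial_mul, one_mul]; rfl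

theorem mk_eq_sum (f : MvPolynomial (Fin m) k) :
    faceMk k K f =
      ∑ a ∈ f.support, f.coeff a • faceMonomial k K a := by
  conv_lhs => rw [f.as_sum, map_sum]
  refine Finset.sum_congr rfl fun a _ => ?_
  rw [faceMonomial, ← map_smul, smul_monomial, smul_eq_mul, mul_one]

theorem faceMonomial_linearIndependent :
    LinearIndependent k fun a : {a : Fin m →₀ ℕ // IsSimplex K a.support} =>
      faceMonomial k K a.1 := by
  classical
  rw [linearIndependent_iff']
  intro s g hg a ha
  have h : ∑ a ∈ s, g a • faceMonomial k K a.1 =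
      faceMk k K (∑ a ∈ s, monomial a.1 (g a)) := by
    rw [map_sum]
    refine Finset.sum_congr rfl fun a _ => ?_
    rw [faceMonomial, ← map_smul, smul_monomial, smul_eq_mul, mul_one]
  rw [h, faceMk_eq_zero, mem_stanleyReisnerIdeal] at hg
  by_contra hne
  refine hg a.1 ?_ a.2
  rw [mem_support_iff, coeff_sum]
  simp only [coeff_monomial]
  rw [Finset.sum_eq_single a]
  · simpa using hne
  · intro b _ hb
    rw [if_neg fun h => hb (Subtype.ext h)]
  · intro h; exact absurd ha h

/-- The monomial basis of the face ring. -/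
noncomputable def faceBasis :
    Module.Basis {a : Fin m →₀ ℕ // IsSimplex K a.support} k (FaceRing k K) :=
  Module.Basis.mk (faceMonomial_linearIndependent k K) <| by
    rintro x -
    obtain ⟨f, rfl⟩ := faceMk_surjective k K x
    rw [mk_eq_sum]
    refine Submodule.sum_mem _ fun a _ => Submodule.smul_mem _ _ ?_
    by_cases ha : IsSimplex K a.support
    · exact Submodule.subset_span ⟨⟨a, ha⟩, rfl⟩
    · rw [faceMonomial_eq_zero k K ha]; exact zero_mem _

end FaceRing

section Exterior

variable {m : ℕ} (k : Type) [CommRing k]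

/-- The exterior algebra `Λ[u_1, …, u_m]`. -/
abbrev ExtAlg (m : ℕ) : Type := ExteriorAlgebra k (Fin m → k)

/-- The generators `u_i` of the exterior algebra. -/
noncomputable def extVar (i : Fin m) : ExtAlg k m := ExteriorAlgebra.ι k (Pi.single i 1)

/-- The monomial `u_J`, the product of the `u_j` for `j ∈ J` in increasing order. -/
noncomputable def extMonomial (J : Finset (Fin m)) : ExtAlg k m := (J.sort.map (extVar k)).prod

noncomputable def extBasis : Module.Basis (Finset (Fin m)) k (ExtAlg k m) :=
  (Pi.basisFun k (Fin m)).ExteriorAlgebra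

theorem extBasis_apply (J : Finset (Fin m)) : extBasis k J = extMonomial k J := by
  rw [extBasis, ExteriorAlgebra.basis_apply_ofCard (s := J) _ rfl, ExteriorAlgebra.ιMulti_family,
    ExteriorAlgebra.ιMulti_apply, extMonomial]
  congr 1
  refine List.ext_getElem (by simp) fun i h1 h2 => ?_
  simp [extVar, Set.powersetCard.ofFinEmbEquiv_symm_apply, Finset.orderEmbOfFin_apply]

theorem extMonomial_empty : extMonomial k (∅ : Finset (Fin m)) = 1 := by
  simp [extMonomial]

theorem extMonomial_insert {j : Fin m} {J : Finset (Fin m)} (h : ∀ i ∈ J, j < i) :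
    extMonomial k (insert j J) = extVar k j * extMonomial k J := by
  rw [extMonomial, Finset.sort_insert _ (fun i hi => (h i hi).le)
    (fun hj => lt_irrefl _ (h j hj))]
  simp [extMonomial]

theorem extMonomial_singleton (j : Fin m) : extMonomial k {j} = extVar k j := by
  simp [extMonomial]

theorem extMonomial_mem (J : Finset (Fin m)) :
    extMonomial k J ∈ ⋀[k]^(J.card) (Fin m → k) := by
  rw [← extBasis_apply, extBasis, ExteriorAlgebra.basis_apply_ofCard (s := J) _ rfl]
  exact ExteriorAlgebra.ιMulti_range k _ ⟨_, rfl⟩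

theorem extBasis_mul {p q : ℕ} (s : Set.powersetCard (Fin m) p) (t : Set.powersetCard (Fin m) q) :
    ∃ c : k, extBasis k s.1 * extBasis k t.1 = c • extBasis k (s.1 ∪ t.1) := by
  by_cases h : Disjoint s.1 t.1
  · refine ⟨((Set.powersetCard.permOfDisjoint h).sign : ℤ), ?_⟩
    rw [Int.cast_smul_eq_zsmul k, ← Units.smul_def, ← Finset.disjUnion_eq_union _ _ h]
    exact ExteriorAlgebra.basis_mul_of_disjoint (Pi.basisFun k (Fin m)) s t h
  · refine ⟨0, ?_⟩
    rw [zero_smul]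
    exact ExteriorAlgebra.basis_mul_of_not_disjoint (Pi.basisFun k (Fin m)) s t h

theorem extMonomial_mul (I J : Finset (Fin m)) :
    ∃ c : k, extMonomial k I * extMonomial k J = c • extMonomial k (I ∪ J) := by
  simp only [← extBasis_apply]
  exact extBasis_mul k (Set.powersetCard.ofCard (rfl : I.card = I.card))
    (Set.powersetCard.ofCard (rfl : J.card = J.card))

/-- The derivation of the exterior algebra with `u_j ↦ 1` if `j = i` and `u_j ↦ 0` otherwise. -/
noncomputable def extContract (i : Fin m) : ExtAlg k m →ₗ[k] ExtAlg k m :=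
  CliffordAlgebra.contractLeft (Q := (0 : QuadraticForm k (Fin m → k))) (LinearMap.proj i)

theorem extContract_mul (i j : Fin m) (x : ExtAlg k m) :
    extContract k i (extVar k j * x) =
      (if i = j then x else 0) - extVar k j * extContract k i x := by
  have := CliffordAlgebra.contractLeft_ι_mul (Q := (0 : QuadraticForm k (Fin m → k)))
    (LinearMap.proj i) (Pi.single j 1) x
  refine this.trans ?_
  rw [LinearMap.proj_apply, Pi.single_apply, ite_smul, one_smul, zero_smul]
  rfl

theorem extContract_one (i : Fin m) : extContract k i 1 = 0 :=
  CliffordAlgebra.contractLeft_one (Q := (0 : QuadraticForm k (Fin m → k))) _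

theorem extContract_comp (i : Fin m) (x : ExtAlg k m) : extContract k i (extContract k i x) = 0 :=
  CliffordAlgebra.contractLeft_contractLeft _ _

theorem extContract_comm (i j : Fin m) (x : ExtAlg k m) :
    extContract k i (extContract k j x) = - extContract k j (extContract k i x) :=
  CliffordAlgebra.contractLeft_comm _ _ _

theorem extContract_monomial (i : Fin m) (J : Finset (Fin m)) :
    extContract k i (extMonomial k J) =
      if i ∈ J then eps k i J • extMonomial k (J.erase i) else 0 := by
  induction J using Finset.induction_on_min with
  | empty => simp [extMonomial_empty, extContract_one]
  | insert j J hj ih =>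
    have hjJ : j ∉ J := fun h => lt_irrefl _ (hj j h)
    rw [extMonomial_insert k hj, extContract_mul, ih]
    by_cases hij : i = j
    · subst hij
      rw [if_pos rfl, if_neg hjJ, mul_zero, sub_zero, if_pos (Finset.mem_insert_self _ _),
        Finset.erase_insert hjJ]
      have : eps k i (insert i J) = 1 := by
        rw [eps_insert_self, eps, Finset.filter_false_of_mem fun l hl => (hj l hl).not_gt]
        simp
      rw [this, one_smul]
    · rw [if_neg hij, zero_sub]
      by_cases hi : i ∈ J
      · rw [if_pos hi, if_pos (Finset.mem_insert_of_mem hi), Finset.erase_insert_of_ne (Ne.symm hij), extMonomial_insert k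
          fun l hl => hj l (Finset.mem_of_mem_erase hl), eps_insert hjJ, if_pos (hj i hi),
          mul_smul_comm, neg_one_mul, neg_smul]
      · rw [if_neg hi, if_neg (by simp [hij, hi]), mul_zero, neg_zero]

end Exterior

section Koszul

open TensorProduct

variable {m : ℕ} (k : Type) [CommRing k] (K : PreAbstractSimplicialComplex (Fin m))

/-- The Koszul algebra `Λ[u_1, …, u_m] ⊗ k[K]`. The `v_i` having even degree, the multiplication is
that of the ordinary tensor product of algebras. -/
abbrev Koszul : Type := ExtAlg k m ⊗[k] FaceRing k K

/-- The generators `v_i` of the face ring. -/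
noncomputable def faceVar (i : Fin m) : FaceRing k K := faceMk k K (MvPolynomial.X i)

/-- The generators `u_i` of the Koszul algebra. -/
noncomputable def koszulU (i : Fin m) : Koszul k K := extVar k i ⊗ₜ 1

/-- The generators `v_i` of the Koszul algebra. -/
noncomputable def koszulV (i : Fin m) : Koszul k K := 1 ⊗ₜ faceVar k K i

/-- The component of bidegree `(a, b)`, where `u_i` has bidegree `(-1, 2)` and `v_i` has bidegree
`(0, 2)`. -/
noncomputable def koszulGr (ab : ℤ × ℤ) : Submodule k (Koszul k K) :=
  Submodule.span k {x | ∃ (r n : ℕ) (w : ExtAlg k m) (p : MvPolynomial (Fin m) k),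
    w ∈ ⋀[k]^r (Fin m → k) ∧ p.IsHomogeneous n ∧ ab = (-(r : ℤ), 2 * ((r : ℤ) + n)) ∧
    x = w ⊗ₜ faceMk k K p}

/-- The `k[K]`-linear graded derivation of the Koszul algebra that sends `u_i` to `c_i`; see the
three lemmas below, which determine it. -/
noncomputable def koszulDerivation (c : Fin m → FaceRing k K) : Koszul k K →ₗ[k] Koszul k K :=
  ∑ i, TensorProduct.map (extContract k i) (LinearMap.mulLeft k (c i))

theorem koszulDerivation_tmul (c : Fin m → FaceRing k K) (w : ExtAlg k m) (p : FaceRing k K) :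
    koszulDerivation k K c (w ⊗ₜ p) = ∑ i, extContract k i w ⊗ₜ[k] (c i * p) := by
  simp [koszulDerivation]

theorem koszulDerivation_one (c : Fin m → FaceRing k K) : koszulDerivation k K c 1 = 0 := by
  rw [Algebra.TensorProduct.one_def, koszulDerivation_tmul]
  simp [extContract_one]

theorem koszulDerivation_u_mul (c : Fin m → FaceRing k K) (i : Fin m) (x : Koszul k K) :
    koszulDerivation k K c (koszulU k K i * x) =
      (1 ⊗ₜ c i) * x - koszulU k K i * koszulDerivation k K c x := by
  induction x using TensorProduct.induction_on with
  | zero => simp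
  | add x y hx hy => rw [mul_add, map_add, hx, hy, map_add]; noncomm_ring
  | tmul w p =>
    simp only [koszulU, Algebra.TensorProduct.tmul_mul_tmul, koszulDerivation_tmul, one_mul,
      extContract_mul, TensorProduct.sub_tmul, Finset.sum_sub_distrib, Finset.mul_sum,
      TensorProduct.ite_tmul, Finset.sum_ite_eq', Finset.mem_univ, if_true]

theorem koszulDerivation_v_mul (c : Fin m → FaceRing k K) (i : Fin m) (x : Koszul k K) :
    koszulDerivation k K c (koszulV k K i * x) = koszulV k K i * koszulDerivation k K c x := by
  induction x using TensorProduct.induction_on with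
  | zero => simp
  | add x y hx hy => rw [mul_add, map_add, hx, hy, map_add, mul_add]
  | tmul w p =>
    simp only [koszulV, Algebra.TensorProduct.tmul_mul_tmul, koszulDerivation_tmul, one_mul,
      Finset.mul_sum, mul_left_comm]

theorem koszulDerivation_anticomm (c e : Fin m → FaceRing k K) :
    koszulDerivation k K c ∘ₗ koszulDerivation k K e =
      - (koszulDerivation k K e ∘ₗ koszulDerivation k K c) := by
  refine TensorProduct.ext' fun w p => ?_
  simp only [LinearMap.comp_apply, LinearMap.neg_apply, koszulDerivation_tmul, map_sum]
  rw [Finset.sum_comm, ← Finset.sum_neg_distrib]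
  refine Finset.sum_congr rfl fun i _ => ?_
  rw [← Finset.sum_neg_distrib]
  refine Finset.sum_congr rfl fun j _ => ?_
  rw [extContract_comm, TensorProduct.neg_tmul, mul_left_comm]

theorem koszulDerivation_comp_self (c : Fin m → FaceRing k K) :
    koszulDerivation k K c ∘ₗ koszulDerivation k K c = 0 := by
  refine TensorProduct.ext' fun w p => ?_
  simp only [LinearMap.comp_apply, LinearMap.zero_apply, koszulDerivation_tmul, map_sum]
  rw [← sum_antisymm (A := Koszul k K) Finset.univ
    (fun i j => extContract k j (extContract k i w) ⊗ₜ[k] (c j * (c i * p)))]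
  · refine Finset.sum_congr rfl fun i hi => ?_
    rw [← Finset.add_sum_erase _ _ hi, extContract_comp, TensorProduct.zero_tmul, zero_add]
  · intro i _ j _ _
    rw [extContract_comm, TensorProduct.neg_tmul, mul_left_comm]

/-- The Koszul differential: `d u_i = v_i`, `d v_i = 0`. -/
noncomputable def koszulD : Koszul k K →ₗ[k] Koszul k K := koszulDerivation k K (faceVar k K)

/-- The second differential: `d' u_i = 1`, `d' v_i = 0`. -/
noncomputable def koszulD' : Koszul k K →ₗ[k] Koszul k K := koszulDerivation k K 1

/-- The monomials of the Koszul algebra. -/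
noncomputable def koszulMonomial (J : Finset (Fin m)) (a : Fin m →₀ ℕ) : Koszul k K :=
  extMonomial k J ⊗ₜ faceMonomial k K a

/-- The span of a set of monomials. -/
noncomputable def monomialSpan (P : Finset (Fin m) → (Fin m →₀ ℕ) → Prop) : Submodule k (Koszul k K) :=
  Submodule.span k {x | ∃ J a, P J a ∧ x = koszulMonomial k K J a}

theorem koszulD_monomial (J : Finset (Fin m)) (a : Fin m →₀ ℕ) :
    koszulD k K (koszulMonomial k K J a) =
      ∑ i ∈ J, eps k i J • koszulMonomial k K (J.erase i) (Finsupp.single i 1 + a) := by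
  rw [koszulD, koszulMonomial, koszulDerivation_tmul, ← Finset.sum_filter_add_sum_filter_not
    Finset.univ (· ∈ J), Finset.filter_univ_mem, add_eq_left.2]
  · refine Finset.sum_congr rfl fun i hi => ?_
    rw [extContract_monomial, if_pos hi, koszulMonomial, ← faceMonomial_mul,
      TensorProduct.smul_tmul']
    rfl
  · refine Finset.sum_eq_zero fun i hi => ?_
    rw [extContract_monomial, if_neg (Finset.mem_filter.1 hi).2, TensorProduct.zero_tmul]

theorem koszulD'_monomial (J : Finset (Fin m)) (a : Fin m →₀ ℕ) :
    koszulD' k K (koszulMonomial k K J a) =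
      ∑ i ∈ J, eps k i J • koszulMonomial k K (J.erase i) a := by
  rw [koszulD', koszulMonomial, koszulDerivation_tmul, ← Finset.sum_filter_add_sum_filter_not
    Finset.univ (· ∈ J), Finset.filter_univ_mem, add_eq_left.2]
  · refine Finset.sum_congr rfl fun i hi => ?_
    rw [extContract_monomial, if_pos hi, koszulMonomial, Pi.one_apply, one_mul,
      TensorProduct.smul_tmul']
  · refine Finset.sum_eq_zero fun i hi => ?_
    rw [extContract_monomial, if_neg (Finset.mem_filter.1 hi).2, TensorProduct.zero_tmul]

variable {k K}

theorem koszulD_mem {P Q : Finset (Fin m) → (Fin m →₀ ℕ) → Prop}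
    (h : ∀ J a, P J a → ∀ i ∈ J, Q (J.erase i) (Finsupp.single i 1 + a)) {x : Koszul k K}
    (hx : x ∈ monomialSpan k K P) : koszulD k K x ∈ monomialSpan k K Q := by
  suffices monomialSpan k K P ≤ (monomialSpan k K Q).comap (koszulD k K) from this hx
  refine Submodule.span_le.2 ?_
  rintro _ ⟨J, a, hP, rfl⟩
  change koszulD k K _ ∈ monomialSpan k K Q
  rw [koszulD_monomial]
  exact Submodule.sum_mem _ fun i hi => Submodule.smul_mem _ _ <|
    Submodule.subset_span ⟨_, _, h J a hP i hi, rfl⟩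

theorem koszulD'_mem {P Q : Finset (Fin m) → (Fin m →₀ ℕ) → Prop}
    (h : ∀ J a, P J a → ∀ i ∈ J, Q (J.erase i) a) {x : Koszul k K}
    (hx : x ∈ monomialSpan k K P) : koszulD' k K x ∈ monomialSpan k K Q := by
  suffices monomialSpan k K P ≤ (monomialSpan k K Q).comap (koszulD' k K) from this hx
  refine Submodule.span_le.2 ?_
  rintro _ ⟨J, a, hP, rfl⟩
  change koszulD' k K _ ∈ monomialSpan k K Q
  rw [koszulD'_monomial]
  exact Submodule.sum_mem _ fun i hi => Submodule.smul_mem _ _ <|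
    Submodule.subset_span ⟨_, _, h J a hP i hi, rfl⟩

variable (k K)

/-- The monomial basis of the Koszul algebra. -/
noncomputable def koszulBasis :
    Module.Basis (Finset (Fin m) × {a : Fin m →₀ ℕ // IsSimplex K a.support}) k (Koszul k K) :=
  (extBasis k).tensorProduct (faceBasis k K)

theorem koszulBasis_apply (i : Finset (Fin m) × {a : Fin m →₀ ℕ // IsSimplex K a.support}) :
    koszulBasis k K i = koszulMonomial k K i.1 i.2.1 := by
  rw [koszulBasis, Module.Basis.tensorProduct_apply', extBasis_apply, faceBasis,
    Module.Basis.mk_apply, koszulMonomial]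

theorem monomialSpan_eq (P : Finset (Fin m) → (Fin m →₀ ℕ) → Prop) :
    monomialSpan k K P = Submodule.span k (koszulBasis k K '' {i | P i.1 i.2.1}) := by
  refine le_antisymm (Submodule.span_le.2 ?_) (Submodule.span_le.2 ?_)
  · rintro _ ⟨J, a, h, rfl⟩
    by_cases ha : IsSimplex K a.support
    · exact Submodule.subset_span ⟨(J, ⟨a, ha⟩), h, koszulBasis_apply k K _⟩
    · rw [koszulMonomial, faceMonomial_eq_zero k K ha, TensorProduct.tmul_zero]
      exact zero_mem _
  · rintro _ ⟨i, h, rfl⟩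
    exact Submodule.subset_span ⟨_, _, h, koszulBasis_apply k K i⟩

theorem mem_span_extMonomial {n : ℕ} {w : ExtAlg k m} (hw : w ∈ ⋀[k]^n (Fin m → k)) :
    w ∈ Submodule.span k (extMonomial k '' {J : Finset (Fin m) | J.card = n}) := by
  have h := ((Pi.basisFun k (Fin m)).exteriorPower n).mem_span ⟨w, hw⟩
  have h2 := Submodule.mem_map_of_mem (f := Submodule.subtype _) h
  rw [Submodule.map_span] at h2
  refine Submodule.span_mono ?_ h2
  rintro _ ⟨_, ⟨s, rfl⟩, rfl⟩
  refine ⟨s.1, s.2, ?_⟩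
  rw [← extBasis_apply]
  exact ExteriorAlgebra.basis_eq_coe_basis _ s

theorem koszulGr_eq (p : ℤ × ℤ) : koszulGr k K p =
    monomialSpan k K fun J a => (-(J.card : ℤ), 2 * ((J.card : ℤ) + a.degree)) = p := by
  refine le_antisymm (Submodule.span_le.2 ?_) (Submodule.span_le.2 ?_)
  · rintro _ ⟨r, n, w, f, hw, hf, rfl, rfl⟩
    rw [mk_eq_sum, TensorProduct.tmul_sum]
    refine Submodule.sum_mem _ fun a ha => ?_
    rw [TensorProduct.tmul_smul]
    refine Submodule.smul_mem _ _ ?_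
    have hn : a.degree = n := by
      have := hf (MvPolynomial.mem_support_iff.1 ha)
      rwa [Finsupp.degree_eq_weight_one]
    let T : ExtAlg k m →ₗ[k] Koszul k K := (TensorProduct.mk k _ _).flip (faceMonomial k K a)
    have h := Submodule.mem_map_of_mem (f := T) (mem_span_extMonomial k hw)
    rw [Submodule.map_span] at h
    refine Submodule.span_mono ?_ h
    rintro _ ⟨_, ⟨J, hJ, rfl⟩, rfl⟩
    refine ⟨J, a, ?_, rfl⟩
    change (-(J.card : ℤ), 2 * ((J.card : ℤ) + a.degree)) = _
    rw [hn, show J.card = r from hJ]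
  · rintro _ ⟨J, a, rfl, rfl⟩
    refine Submodule.subset_span ⟨J.card, a.degree, _, MvPolynomial.monomial a 1,
      extMonomial_mem k J, MvPolynomial.isHomogeneous_monomial 1 rfl, rfl, rfl⟩

/-- The Koszul bicomplex. -/
noncomputable def koszulBicomplex : Bicomplex k where
  X := Koszul k K
  gr := koszulGr k K
  d := koszulD k K
  d' := koszulD' k K
  isInternal := isInternal_of_basis (koszulBasis k K)
    (fun i => (-(i.1.card : ℤ), 2 * ((i.1.card : ℤ) + i.2.1.degree))) _ fun p => by
      rw [koszulGr_eq, monomialSpan_eq]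
  d_mem p x hx := by
    rw [koszulGr_eq] at hx ⊢
    refine koszulD_mem (fun J a h i hi => ?_) hx
    have := Finset.card_erase_add_one hi
    rw [← h, map_add, Finsupp.degree_single]
    ext <;> simp only [Prod.fst_add, Prod.snd_add] <;> push_cast <;> omega
  d'_mem p x hx := by
    rw [koszulGr_eq] at hx ⊢
    refine koszulD'_mem (fun J a h i hi => ?_) hx
    have := Finset.card_erase_add_one hi
    rw [← h]
    ext <;> simp only [Prod.fst_add, Prod.snd_add] <;> omega
  d_comp_d := koszulDerivation_comp_self k K _
  d'_comp_d' := koszulDerivation_comp_self k K _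
  anticomm := koszulDerivation_anticomm k K _ _

end Koszul

section Reduced

open TensorProduct

variable {m : ℕ} (k : Type) [CommRing k] (K : PreAbstractSimplicialComplex (Fin m))

/-- The two-sided ideal of the Koszul algebra generated by the `v_i ^ 2` and the `u_i v_i`. -/
noncomputable def reducedIdeal : TwoSidedIdeal (Koszul k K) :=
  TwoSidedIdeal.span {x | ∃ i, x = koszulV k K i ^ 2 ∨ x = koszulU k K i * koszulV k K i}

/-- The same ideal as a `k`-submodule. -/
noncomputable def reducedIdealSubmodule : Submodule k (Koszul k K) :=
  (reducedIdeal k K).asIdeal.restrictScalars k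

/-- The quotient `R^*(K)` of the Koszul algebra by the ideal generated by the `v_i ^ 2` and the
`u_i v_i`, as a module. -/
abbrev Reduced : Type := Koszul k K ⧸ reducedIdealSubmodule k K

/-- The submodule of the Koszul algebra spanned by the monomials `u_J v_I` with `J ∩ I = ∅`. -/
noncomputable def disjointSubmodule : Submodule k (Koszul k K) :=
  Submodule.span k {x | ∃ J I : Finset (Fin m), Disjoint J I ∧
    x = extMonomial k J ⊗ₜ ∏ i ∈ I, faceVar k K i}

def BadMonomial (J : Finset (Fin m)) (a : Fin m →₀ ℕ) : Prop :=
  ∃ i, 2 ≤ a i ∨ (i ∈ J ∧ 1 ≤ a i)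

theorem koszulV_eq (i : Fin m) :
    koszulV k K i = koszulMonomial k K ∅ (Finsupp.single i 1) := by
  rw [koszulMonomial, extMonomial_empty]; rfl

theorem koszulU_eq (i : Fin m) : koszulU k K i = koszulMonomial k K {i} 0 := by
  rw [koszulMonomial, extMonomial_singleton]; rfl

theorem koszulMonomial_mul (I J : Finset (Fin m)) (a b : Fin m →₀ ℕ) : ∃ c : k,
    koszulMonomial k K I a * koszulMonomial k K J b = c • koszulMonomial k K (I ∪ J) (a + b) := by
  obtain ⟨c, hc⟩ := extMonomial_mul k I J
  refine ⟨c, ?_⟩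
  rw [koszulMonomial, koszulMonomial, Algebra.TensorProduct.tmul_mul_tmul, hc, faceMonomial_mul,
    koszulMonomial, TensorProduct.smul_tmul']

theorem monomialSpan_top : monomialSpan k K (fun _ _ => True) = ⊤ := by
  rw [monomialSpan_eq]
  simp [(koszulBasis k K).span_eq]

theorem bad_mul_mem {x : Koszul k K} (hx : x ∈ monomialSpan k K BadMonomial) (y : Koszul k K) :
    y * x ∈ monomialSpan k K BadMonomial ∧ x * y ∈ monomialSpan k K BadMonomial := by
  have hy : y ∈ monomialSpan k K fun _ _ => True := by rw [monomialSpan_top]; trivial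
  induction hy using Submodule.span_induction with
  | zero => simp
  | add y z _ _ hy hz =>
    rw [mul_add, add_mul]
    exact ⟨add_mem hy.1 hz.1, add_mem hy.2 hz.2⟩
  | smul c y _ hy =>
    rw [smul_mul_assoc, mul_smul_comm]
    exact ⟨Submodule.smul_mem _ _ hy.1, Submodule.smul_mem _ _ hy.2⟩
  | mem y hy =>
    obtain ⟨J, b, -, rfl⟩ := hy
    induction hx using Submodule.span_induction with
    | zero => simp
    | add x z _ _ hx hz =>
      rw [mul_add, add_mul]
      exact ⟨add_mem hx.1 hz.1, add_mem hx.2 hz.2⟩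
    | smul c x _ hx =>
      rw [smul_mul_assoc, mul_smul_comm]
      exact ⟨Submodule.smul_mem _ _ hx.1, Submodule.smul_mem _ _ hx.2⟩
    | mem x hx =>
      obtain ⟨I, a, ⟨i, hi⟩, rfl⟩ := hx
      obtain ⟨c, hc⟩ := koszulMonomial_mul k K I J a b
      obtain ⟨c', hc'⟩ := koszulMonomial_mul k K J I b a
      rw [hc, hc']
      constructor <;> refine Submodule.smul_mem _ _ (Submodule.subset_span ⟨_, _, ⟨i, ?_⟩, rfl⟩)
      · rw [Finsupp.add_apply, Finset.mem_union]
        rcases hi with hi | ⟨hi, hi'⟩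
        · left; omega
        · right; exact ⟨Or.inr hi, by omega⟩
      · rw [Finsupp.add_apply, Finset.mem_union]
        rcases hi with hi | ⟨hi, hi'⟩
        · left; omega
        · right; exact ⟨Or.inl hi, by omega⟩

theorem bad_le_reducedIdeal : monomialSpan k K BadMonomial ≤ reducedIdealSubmodule k K := by
  refine Submodule.span_le.2 ?_
  rintro _ ⟨J, a, ⟨i, hi⟩, rfl⟩
  change koszulMonomial k K J a ∈ reducedIdeal k K
  rcases hi with hi | ⟨hi, hi'⟩
  · have h : koszulMonomial k K J a = koszulMonomial k K J (a - Finsupp.single i 2) *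
        koszulV k K i ^ 2 := by
      rw [koszulV, Algebra.TensorProduct.tmul_pow, one_pow, koszulMonomial,
        koszulMonomial, Algebra.TensorProduct.tmul_mul_tmul, mul_one, sq]
      congr 1
      change _ = faceMonomial k K _ * (faceMonomial k K _ * faceMonomial k K _)
      rw [faceMonomial_mul, faceMonomial_mul, ← Finsupp.single_add]
      congr 1
      refine (tsub_add_cancel_of_le ?_).symm
      rwa [Finsupp.single_le_iff]
    rw [h]
    exact TwoSidedIdeal.mul_mem_left _ _ _ (TwoSidedIdeal.subset_span ⟨i, Or.inl rfl⟩)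
  · -- `u_J` is a multiple of `u_i`
    have h : ∃ y, extMonomial k J = y * extVar k i := by
      obtain ⟨l₁, l₂, hl⟩ := List.append_of_mem ((Finset.mem_sort (r := (· ≤ ·))).2 hi)
      have hc : ∀ l : List (Fin m), ∃ z : ExtAlg k m,
          extVar k i * (l.map (extVar k)).prod = z * extVar k i := by
        intro l
        induction l with
        | nil => exact ⟨1, by simp⟩
        | cons j l ih =>
          obtain ⟨z, hz⟩ := ih
          refine ⟨-(extVar k j * z), ?_⟩
          have h1 : extVar k i * extVar k j = - (extVar k j * extVar k i) :=
            eq_neg_of_add_eq_zero_left (ExteriorAlgebra.ι_add_mul_swap _ _)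
          rw [List.map_cons, List.prod_cons, ← mul_assoc, h1, neg_mul, mul_assoc, hz, neg_mul,
            mul_assoc]
      obtain ⟨z, hz⟩ := hc l₂
      refine ⟨(l₁.map (extVar k)).prod * z, ?_⟩
      rw [extMonomial, hl, List.map_append, List.prod_append, List.map_cons, List.prod_cons, hz,
        mul_assoc]
    obtain ⟨y, hy⟩ := h
    have h : koszulMonomial k K J a = (y ⊗ₜ faceMonomial k K (a - Finsupp.single i 1)) *
        (koszulU k K i * koszulV k K i) := by
      rw [koszulV, koszulU, Algebra.TensorProduct.tmul_mul_tmul,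
        Algebra.TensorProduct.tmul_mul_tmul, mul_one, one_mul, ← hy, koszulMonomial]
      congr 1
      change _ = faceMonomial k K _ * faceMonomial k K _
      rw [faceMonomial_mul]
      congr 1
      refine (tsub_add_cancel_of_le ?_).symm
      rwa [Finsupp.single_le_iff]
    rw [h]
    exact TwoSidedIdeal.mul_mem_left _ _ _ (TwoSidedIdeal.subset_span ⟨i, Or.inr rfl⟩)

theorem reducedIdealSubmodule_eq :
    reducedIdealSubmodule k K = monomialSpan k K BadMonomial := by
  refine le_antisymm ?_ (bad_le_reducedIdeal k K)
  intro x hx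
  let T : TwoSidedIdeal (Koszul k K) := TwoSidedIdeal.mk'
    (monomialSpan k K BadMonomial : Set (Koszul k K)) (zero_mem _) (fun h h' => add_mem h h')
    (fun h => neg_mem h) (fun {y x} h => (bad_mul_mem k K h y).1)
    (fun {x y} h => (bad_mul_mem k K h y).2)
  have hT : ∀ y, y ∈ T ↔ y ∈ monomialSpan k K BadMonomial := fun y => TwoSidedIdeal.mem_mk' ..
  rw [← hT]
  have hle : reducedIdeal k K ≤ T := by
    refine TwoSidedIdeal.span_le.2 ?_
    rintro _ ⟨i, rfl | rfl⟩
    · refine (hT _).2 ?_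
      obtain ⟨c, hc⟩ := koszulMonomial_mul k K ∅ ∅ (Finsupp.single i 1) (Finsupp.single i 1)
      rw [sq, koszulV_eq, hc]
      exact Submodule.smul_mem _ _ (Submodule.subset_span ⟨_, _, ⟨i, Or.inl (by simp)⟩, rfl⟩)
    · refine (hT _).2 ?_
      obtain ⟨c, hc⟩ := koszulMonomial_mul k K {i} ∅ 0 (Finsupp.single i 1)
      rw [koszulU_eq, koszulV_eq, hc]
      exact Submodule.smul_mem _ _ (Submodule.subset_span ⟨_, _, ⟨i, Or.inr (by simp)⟩, rfl⟩)
  exact hle hx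

theorem prod_faceVar (I : Finset (Fin m)) :
    ∏ i ∈ I, faceVar k K i = faceMonomial k K (sqfree I) := by
  simp only [faceVar]
  rw [← map_prod, prod_X_eq_monomial]
  rfl

theorem disjointSubmodule_eq :
    disjointSubmodule k K = monomialSpan k K fun J a => ¬ BadMonomial J a := by
  unfold disjointSubmodule monomialSpan
  congr 1
  ext x
  constructor
  · rintro ⟨J, I, hd, rfl⟩
    refine ⟨J, sqfree I, ?_, by rw [prod_faceVar]; rfl⟩
    rintro ⟨i, h⟩
    rw [sqfree_apply] at h
    have := fun hJ : i ∈ J => Finset.disjoint_left.1 hd hJ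
    split_ifs at h with hi
    · rcases h with h | h
      · omega
      · exact this h.1 hi
    · omega
  · rintro ⟨J, a, h, rfl⟩
    have h : ∀ i, a i < 2 ∧ (i ∈ J → a i < 1) := by
      intro i
      constructor
      · by_contra h'; exact h ⟨i, Or.inl (by omega)⟩
      · intro hi; by_contra h'; exact h ⟨i, Or.inr ⟨hi, by omega⟩⟩
    have ha : a = sqfree a.support := by
      ext i
      rw [sqfree_apply]
      split_ifs with hi
      · have := (h i).1; have := Finsupp.mem_support_iff.1 hi; omega
      · simpa using hi
    refine ⟨J, a.support, ?_, ?_⟩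
    · rw [Finset.disjoint_left]
      intro i hi hi'
      have := (h i).2 hi; have := Finsupp.mem_support_iff.1 hi'; omega
    · rw [prod_faceVar, ← ha]; rfl

theorem reduced_isCompl : IsCompl (reducedIdealSubmodule k K) (disjointSubmodule k K) := by
  rw [reducedIdealSubmodule_eq, disjointSubmodule_eq, monomialSpan_eq, monomialSpan_eq]
  constructor
  · rcases subsingleton_or_nontrivial k with hk | hk
    · have := Module.subsingleton k (Koszul k K)
      rw [disjoint_iff]
      exact Subsingleton.elim _ _
    · refine (koszulBasis k K).linearIndependent.disjoint_span_image ?_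
      rw [Set.disjoint_left]
      intro i hi hi'
      exact hi' hi
  · rw [codisjoint_iff, ← Submodule.span_union, ← Set.image_union, eq_top_iff,
      ← (koszulBasis k K).span_eq]
    refine Submodule.span_mono ?_
    rintro _ ⟨i, rfl⟩
    exact ⟨i, em (BadMonomial i.1 i.2.1), rfl⟩

/-- The identification of the quotient `R^*(K)` with the submodule of the Koszul algebra spanned
by the `u_J v_I` with `J ∩ I = ∅`, inverse to the restriction of the quotient map. -/
noncomputable def reducedEquiv : Reduced k K ≃ₗ[k] disjointSubmodule k K :=
  Submodule.quotientEquivOfIsCompl _ _ (reduced_isCompl k K)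

theorem reducedIdeal_d_mem (x : Koszul k K) (hx : x ∈ reducedIdealSubmodule k K) :
    koszulD k K x ∈ reducedIdealSubmodule k K := by
  rw [reducedIdealSubmodule_eq] at hx ⊢
  refine koszulD_mem (fun J a h i hi => ?_) hx
  obtain ⟨j, hj⟩ := h
  refine ⟨j, ?_⟩
  rw [Finsupp.add_apply, Finsupp.single_apply, Finset.mem_erase]
  by_cases hij : i = j
  · left; rw [if_pos hij]; omega
  · rw [if_neg hij]
    rcases hj with hj | hj
    · left; omega
    · right; exact ⟨⟨Ne.symm hij, hj.1⟩, by omega⟩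

theorem disjointSubmodule_d_mem (x : Koszul k K) (hx : x ∈ disjointSubmodule k K) :
    koszulD k K x ∈ disjointSubmodule k K := by
  rw [disjointSubmodule_eq] at hx ⊢
  refine koszulD_mem (fun J a h i hi => ?_) hx
  rintro ⟨j, hj⟩
  refine h ⟨j, ?_⟩
  rw [Finsupp.add_apply, Finsupp.single_apply, Finset.mem_erase] at hj
  by_cases hij : i = j
  · subst hij
    rw [if_pos rfl] at hj
    right
    exact ⟨hi, by omega⟩
  · rw [if_neg hij] at hj
    rcases hj with hj | hj
    · left; omega
    · right; exact ⟨hj.1.2, by omega⟩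

theorem disjointSubmodule_d'_mem (x : Koszul k K) (hx : x ∈ disjointSubmodule k K) :
    koszulD' k K x ∈ disjointSubmodule k K := by
  rw [disjointSubmodule_eq] at hx ⊢
  refine koszulD'_mem (fun J a h i hi => ?_) hx
  rintro ⟨j, hj⟩
  exact h ⟨j, hj.imp id fun hj => ⟨Finset.mem_of_mem_erase hj.1, hj.2⟩⟩

/-- The differential `d` of the quotient `R^*(K)`. -/
noncomputable def reducedD : Reduced k K →ₗ[k] Reduced k K :=
  Submodule.mapQ _ _ (koszulD k K) (reducedIdeal_d_mem k K)

/-- The differential `d'` of `R^*(K)`: the restriction of the differential `d'` of the Koszul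
algebra to the span of the `u_J v_I` with `J ∩ I = ∅`. -/
noncomputable def reducedD' : Reduced k K →ₗ[k] Reduced k K :=
  (reducedEquiv k K).symm.toLinearMap ∘ₗ
    (koszulD' k K).restrict (disjointSubmodule_d'_mem k K) ∘ₗ (reducedEquiv k K).toLinearMap

theorem reducedD'_mk (x : Koszul k K) (hx : x ∈ disjointSubmodule k K) :
    reducedD' k K (Submodule.Quotient.mk x) = Submodule.Quotient.mk (koszulD' k K x) := by
  have h : reducedEquiv k K (Submodule.Quotient.mk x) = ⟨x, hx⟩ :=
    Submodule.quotientEquivOfIsCompl_apply_mk_right (reduced_isCompl k K) ⟨x, hx⟩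
  change (reducedEquiv k K).symm ((koszulD' k K).restrict (disjointSubmodule_d'_mem k K)
    (reducedEquiv k K (Submodule.Quotient.mk x))) = _
  rw [h]
  rfl

theorem reduced_exists (r : Reduced k K) :
    ∃ x ∈ disjointSubmodule k K, Submodule.Quotient.mk x = r :=
  ⟨(reducedEquiv k K r).1, (reducedEquiv k K r).2, (reducedEquiv k K).symm_apply_apply r⟩

/-- The component of bidegree `p` of `R^*(K)`. -/
noncomputable def reducedGr (p : ℤ × ℤ) : Submodule k (Reduced k K) :=
  (koszulGr k K p).map (Submodule.mkQ _)

theorem koszulBasis_mem_disjointSubmodule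
    (i : {i : Finset (Fin m) × {a : Fin m →₀ ℕ // IsSimplex K a.support} //
      ¬ BadMonomial i.1 i.2.1}) : koszulBasis k K i.1 ∈ disjointSubmodule k K := by
  rw [disjointSubmodule_eq, monomialSpan_eq]
  exact Submodule.subset_span ⟨i.1, i.2, rfl⟩

theorem disjointSubmodule_eq_span : disjointSubmodule k K = Submodule.span k (Set.range
    fun i : {i : Finset (Fin m) × {a : Fin m →₀ ℕ // IsSimplex K a.support} //
      ¬ BadMonomial i.1 i.2.1} => koszulBasis k K i.1) := by
  rw [disjointSubmodule_eq, monomialSpan_eq]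
  congr 1
  ext x
  simp

/-- The basis of `R^*(K)` formed by the `u_J v_I` with `I ∈ K` and `J ∩ I = ∅`. -/
noncomputable def reducedBasis :
    Module.Basis {i : Finset (Fin m) × {a : Fin m →₀ ℕ // IsSimplex K a.support} //
      ¬ BadMonomial i.1 i.2.1} k (Reduced k K) :=
  Module.Basis.mk (v := fun i => (Submodule.Quotient.mk (koszulBasis k K i.1) : Reduced k K))
    (by
      have h := ((koszulBasis k K).linearIndependent.comp _ Subtype.val_injective).map
        (f := Submodule.mkQ (reducedIdealSubmodule k K)) (by
          rw [Submodule.ker_mkQ]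
          have := (reduced_isCompl k K).disjoint.symm
          rw [disjointSubmodule_eq_span] at this
          exact this)
      exact h)
    (by
      rintro r -
      obtain ⟨x, hx, rfl⟩ := reduced_exists k K r
      rw [disjointSubmodule_eq_span] at hx
      have := Submodule.mem_map_of_mem (f := Submodule.mkQ (reducedIdealSubmodule k K)) hx
      rw [Submodule.map_span, ← Set.range_comp] at this
      exact this)

theorem reducedBasis_apply (i : {i : Finset (Fin m) × {a : Fin m →₀ ℕ // IsSimplex K a.support} //
      ¬ BadMonomial i.1 i.2.1}) :
    reducedBasis k K i = Submodule.Quotient.mk (koszulBasis k K i.1) := by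
  exact Module.Basis.mk_apply _ _ i

theorem koszulBasis_mem_koszulGr
    (i : Finset (Fin m) × {a : Fin m →₀ ℕ // IsSimplex K a.support}) :
    koszulBasis k K i ∈ koszulGr k K (-(i.1.card : ℤ), 2 * ((i.1.card : ℤ) + i.2.1.degree)) := by
  rw [koszulGr_eq, monomialSpan_eq]
  exact Submodule.subset_span ⟨i, rfl, rfl⟩

theorem reducedGr_eq (p : ℤ × ℤ) : reducedGr k K p = Submodule.span k (reducedBasis k K ''
    {i | (-(i.1.1.card : ℤ), 2 * ((i.1.1.card : ℤ) + i.1.2.1.degree)) = p}) := by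
  refine le_antisymm ?_ (Submodule.span_le.2 ?_)
  · rw [reducedGr, koszulGr_eq, monomialSpan_eq, Submodule.map_span]
    refine Submodule.span_le.2 ?_
    rintro _ ⟨_, ⟨i, hi, rfl⟩, rfl⟩
    by_cases hb : BadMonomial i.1 i.2.1
    · have : Submodule.mkQ (reducedIdealSubmodule k K) (koszulBasis k K i) = 0 := by
        rw [Submodule.mkQ_apply, Submodule.Quotient.mk_eq_zero, reducedIdealSubmodule_eq,
          monomialSpan_eq]
        exact Submodule.subset_span ⟨i, hb, rfl⟩
      rw [this]
      exact zero_mem _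
    · exact Submodule.subset_span ⟨⟨i, hb⟩, hi, reducedBasis_apply k K _⟩
  · rintro _ ⟨i, rfl, rfl⟩
    rw [reducedBasis_apply]
    exact Submodule.mem_map_of_mem (koszulBasis_mem_koszulGr k K i.1)

/-- The bicomplex `R^*(K)`. -/
noncomputable def reducedBicomplex : Bicomplex k where
  X := Reduced k K
  gr := reducedGr k K
  d := reducedD k K
  d' := reducedD' k K
  isInternal := isInternal_of_basis (reducedBasis k K) _ _ (reducedGr_eq k K)
  d_mem := by
    rintro p _ ⟨x, hx, rfl⟩
    exact Submodule.mem_map_of_mem ((koszulBicomplex k K).d_mem p x hx)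
  d'_mem p r hr := by
    rw [reducedGr_eq] at hr
    suffices h : Submodule.span k _ ≤ (reducedGr k K (p + (1, -2))).comap (reducedD' k K) from h hr
    refine Submodule.span_le.2 ?_
    rintro _ ⟨i, rfl, rfl⟩
    change reducedD' k K _ ∈ reducedGr k K _
    rw [reducedBasis_apply, reducedD'_mk k K _ (koszulBasis_mem_disjointSubmodule k K i)]
    exact Submodule.mem_map_of_mem
      ((koszulBicomplex k K).d'_mem _ _ (koszulBasis_mem_koszulGr k K i.1))
  d_comp_d := by
    refine LinearMap.ext fun r => ?_
    obtain ⟨x, hx, rfl⟩ := reduced_exists k K r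
    have := LinearMap.congr_fun (koszulBicomplex k K).d_comp_d x
    exact congrArg Submodule.Quotient.mk this
  d'_comp_d' := by
    refine LinearMap.ext fun r => ?_
    obtain ⟨x, hx, rfl⟩ := reduced_exists k K r
    rw [LinearMap.comp_apply, reducedD'_mk k K _ hx,
      reducedD'_mk k K _ (disjointSubmodule_d'_mem k K x hx)]
    have := LinearMap.congr_fun (koszulBicomplex k K).d'_comp_d' x
    exact congrArg Submodule.Quotient.mk this
  anticomm := by
    refine LinearMap.ext fun r => ?_
    obtain ⟨x, hx, rfl⟩ := reduced_exists k K r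
    rw [LinearMap.comp_apply, reducedD'_mk k K _ hx, LinearMap.neg_apply, LinearMap.comp_apply]
    have h1 : reducedD k K (Submodule.Quotient.mk x) =
      Submodule.Quotient.mk (koszulD k K x) := rfl
    rw [h1, reducedD'_mk k K _ (disjointSubmodule_d_mem k K x hx)]
    have := LinearMap.congr_fun (koszulBicomplex k K).anticomm x
    exact congrArg Submodule.Quotient.mk this

end Reduced

/-! Everything rests on one map, `cochainToKoszul`, which sends the indicator cochain of a simplex
`L` of `K_I` to `± u_(I \ L) v_L`. The pairs `L ⊆ I` with `L ∈ K` correspond to the disjoint pairs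
`(J, L)` by `J = I \ L`. Up to sign the map is therefore a bijection from a basis of `⊕_I C^*(K_I)`
to the monomial basis of the span `D` of the `u_J v_L` with `J ∩ L = ∅`.

The sign `∏ j ∈ L, ε(j, I)` makes the map commute with both differentials. For `d` this comes down
to `ε(j, I) = ε(j, L) ε(j, I \ L)`. For `d'`, removing `i ∉ L` from `I` changes the sign by `(-1) ^
#L * ε(i, L)`, and `(-1) ^ #L` is the factor `(-1) ^ (p + 1)` in the definition of `d'` on cochains
(`cochainToKoszul_d`, `cochainToKoszul_d'`). Since `D` maps isomorphically onto `R^*(K)`, the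
isomorphism of bicomplexes follows.

For the double cohomology it is enough that the inclusion of `D` in the Koszul algebra is a
`d`-quasi-isomorphism: it commutes with `d'`, so the bijection it induces on `d`-cohomology does
too, and no compatibility of a homotopy with `d'` is needed. The differential `d` replaces a factor
`u_j` by `v_j` and so preserves the number of factors of each index. A monomial lies outside `D`
exactly when some index occurs at least twice. For the first such index `i`, exchanging a `v_i` for
`u_i` defines a map `s` with `ds + sd` equal to the identity on these monomials and to `0` on those
of `D` (`koszulHomotopy_bad`, `koszulHomotopy_not_bad`). Hence `1 - (ds + sd)` is a chain projection
onto `D`.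

Finally, the `d`-cohomology of `⊕_I C^*(K_I)` is computed separately for each `I` and gives the
Hochster sum with its `d'` (`hochsterMap_bijective`, `hochsterMap_dH`). All these maps respect
bidegrees, so taking cohomology with respect to `d'` gives the second statement. -/

/-! ### Classes of cocycles, quasi-isomorphisms and graded parts of cohomology -/

section CohomologyMaps

variable {k : Type} [CommRing k] {X Y : Type} [AddCommGroup X] [Module k X]
  [AddCommGroup Y] [Module k Y] {dX : X →ₗ[k] X} {hX : dX ∘ₗ dX = 0} {dY : Y →ₗ[k] Y}
  {hY : dY ∘ₗ dY = 0}

namespace Cohomology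

/-- The class of a cocycle. -/
def mk (hX : dX ∘ₗ dX = 0) (x : X) (hx : dX x = 0) : Cohomology dX hX :=
  Submodule.Quotient.mk ⟨x, hx⟩

theorem exists_mk (c : Cohomology dX hX) : ∃ x hx, mk hX x hx = c := by
  obtain ⟨⟨x, hx⟩, rfl⟩ := Submodule.Quotient.mk_surjective _ c
  exact ⟨x, hx, rfl⟩

theorem mk_eq_zero {x : X} {hx : dX x = 0} : mk hX x hx = 0 ↔ ∃ z, dX z = x :=
  Submodule.Quotient.mk_eq_zero _

theorem mk_eq_mk {x y : X} {hx : dX x = 0} {hy : dX y = 0} :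
    mk hX x hx = mk hX y hy ↔ ∃ z, dX z = x - y :=
  Submodule.Quotient.eq _

theorem mk_mem_part {G : Submodule k X} {x : X} (hx : dX x = 0) (hG : x ∈ G) :
    mk hX x hx ∈ part dX hX G :=
  ⟨⟨x, hx⟩, hG, rfl⟩

theorem exists_of_mem_part {G : Submodule k X} {c : Cohomology dX hX} (hc : c ∈ part dX hX G) :
    ∃ x ∈ G, ∃ hx, mk hX x hx = c := by
  obtain ⟨⟨x, hx⟩, hG, rfl⟩ := hc
  exact ⟨x, hG, hx, rfl⟩

/-- The isomorphism induced on cohomology by a quasi-isomorphism. -/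
noncomputable def equivOfQuasiIso (φ : X →ₗ[k] Y) (hφ : ∀ x, dY (φ x) = φ (dX x))
    (inj : ∀ x, dX x = 0 → (∃ y, dY y = φ x) → ∃ z, dX z = x)
    (surj : ∀ y, dY y = 0 → ∃ x, dX x = 0 ∧ ∃ w, dY w = y - φ x) :
    Cohomology dX hX ≃ₗ[k] Cohomology dY hY :=
  LinearEquiv.ofBijective
    (Cohomology.map φ (fun x hx => by rw [hφ, hx, map_zero]) (fun x => ⟨φ x, hφ x⟩)) <| by
    constructor
    · refine (injective_iff_map_eq_zero _).2 fun c hc => ?_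
      obtain ⟨x, hx, rfl⟩ := exists_mk c
      exact mk_eq_zero.2 (inj x hx (mk_eq_zero.1 hc))
    · intro c
      obtain ⟨y, hy, rfl⟩ := exists_mk c
      obtain ⟨x, hx, w, hw⟩ := surj y hy
      refine ⟨mk hX x hx, (mk_eq_mk.2 ⟨w, hw⟩).symm⟩

/-- Bijectivity of `E` alone does not put a class of `part dY hY G'` in the image of `part dX hX G`.
Hypothesis `hG'` supplies the missing point: a homologous representative coming from a cocycle in
`G`. The bounding element `w` may be of any degree. -/
theorem map_part_eq (E : Cohomology dX hX ≃ₗ[k] Cohomology dY hY) (φ : X →ₗ[k] Y)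
    (hφ : ∀ x, dX x = 0 → dY (φ x) = 0) (hE : ∀ x hx, E (mk hX x hx) = mk hY (φ x) (hφ x hx))
    {G : Submodule k X} {G' : Submodule k Y} (hG : ∀ x ∈ G, φ x ∈ G')
    (hG' : ∀ y ∈ G', dY y = 0 → ∃ x ∈ G, dX x = 0 ∧ ∃ w, dY w = y - φ x) :
    (part dX hX G).map E.toLinearMap = part dY hY G' := by
  refine le_antisymm ?_ ?_
  · rintro _ ⟨c, hc, rfl⟩
    obtain ⟨x, hxG, hx, rfl⟩ := exists_of_mem_part hc
    change E _ ∈ _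
    rw [hE]
    exact mk_mem_part _ (hG x hxG)
  · intro c hc
    obtain ⟨y, hyG, hy, rfl⟩ := exists_of_mem_part hc
    obtain ⟨x, hxG, hx, w, hw⟩ := hG' y hyG hy
    refine ⟨mk hX x hx, mk_mem_part hx hxG, ?_⟩
    change E _ = _
    rw [hE]
    exact (mk_eq_mk.2 ⟨w, hw⟩).symm

/-- An isomorphism of complexes induces an isomorphism on cohomology that respects gradings. -/
theorem exists_equiv (hX : dX ∘ₗ dX = 0) (hY : dY ∘ₗ dY = 0) (e : X ≃ₗ[k] Y)
    (he : ∀ x, dY (e x) = e (dX x)) :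
    ∃ E : Cohomology dX hX ≃ₗ[k] Cohomology dY hY, ∀ G G', G.map e.toLinearMap = G' →
      (part dX hX G).map E.toLinearMap = part dY hY G' := by
  have hinv : ∀ y, dX (e.symm y) = e.symm (dY y) := fun y =>
    e.injective (by rw [← he, e.apply_symm_apply, e.apply_symm_apply])
  refine ⟨equivOfQuasiIso e.toLinearMap he ?_ ?_, ?_⟩
  · rintro x - ⟨y, hy⟩
    exact ⟨e.symm y, by rw [hinv, hy]; exact e.symm_apply_apply x⟩
  · intro y hy
    exact ⟨e.symm y, by rw [hinv, hy, map_zero], 0, by simp⟩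
  · rintro G _ rfl
    refine map_part_eq _ e.toLinearMap (fun x hx => by
      change dY (e x) = 0
      rw [he, hx, map_zero]) (fun x hx => rfl)
      (fun x hx => Submodule.mem_map_of_mem hx) ?_
    rintro _ ⟨x, hx, rfl⟩ h
    refine ⟨x, hx, e.injective ?_, 0, by simp⟩
    rw [← he, map_zero]
    exact h

end Cohomology

end CohomologyMaps

/-! ### Cohomology of the total cochain complex and the Hochster sum -/

section Hochster

variable {m : ℕ} (k : Type) [CommRing k] (K : PreAbstractSimplicialComplex (Fin m))

/-- The family of the classes of the components of a cocycle of `⊕_I C^*(K_I)`. -/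
noncomputable def hochsterMap : (cochainBicomplex k K).H →ₗ[k] HochsterCohomology k K :=
  Submodule.liftQ _ (LinearMap.pi fun I => Submodule.mkQ _ ∘ₗ
    (LinearMap.proj (R := k) (φ := fun I => Cochain k (fullSubcomplex K I)) I).restrict
      (p := LinearMap.ker (totalCochainD k K))
      (q := LinearMap.ker (coboundary k (fullSubcomplex K I)))
      fun x hx => congrFun hx I) <| by
    rintro ⟨x, hx⟩ ⟨z, hz⟩
    refine funext fun I => (Submodule.Quotient.mk_eq_zero _).2 ?_
    exact ⟨z I, congrFun hz I⟩

theorem hochsterMap_mk (x : TotalCochain k K) (hx : totalCochainD k K x = 0)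
    (I : Finset (Fin m)) :
    hochsterMap k K (Cohomology.mk (cochainBicomplex k K).d_comp_d x hx) I =
      Cohomology.mk (coboundary_comp k (fullSubcomplex K I)) (x I) (congrFun hx I) :=
  rfl

/-- The coboundary acts on each `C^*(K_I)` separately, so cocycles and bounding cochains can be
chosen for each `I` and assembled into a family. -/
theorem hochsterMap_bijective : Function.Bijective (hochsterMap k K) := by
  constructor
  · refine (injective_iff_map_eq_zero _).2 fun c hc => ?_
    obtain ⟨x, hx, rfl⟩ := Cohomology.exists_mk c
    have h : ∀ I, ∃ z, coboundary k (fullSubcomplex K I) z = x I := fun I =>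
      Cohomology.mk_eq_zero.1 (congrFun hc I)
    choose z hz using h
    exact Cohomology.mk_eq_zero.2 ⟨z, funext hz⟩
  · intro c
    choose x hx hxc using fun I => Cohomology.exists_mk (c I)
    exact ⟨Cohomology.mk (cochainBicomplex k K).d_comp_d x (funext hx), funext hxc⟩

/-- Both differentials are given on representatives by the same signed sum of restrictions. -/
theorem hochsterMap_dH (c : (cochainBicomplex k K).H) :
    hochsterMap k K ((cochainBicomplex k K).dH c) = hochsterD' k K (hochsterMap k K c) := by
  obtain ⟨(x : TotalCochain k K), (hx : totalCochainD k K x = 0), rfl⟩ := Cohomology.exists_mk c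
  have hd : totalCochainD k K (totalCochainD' k K x) = 0 := by
    have h := LinearMap.congr_fun (totalCochain_anticomm k K) x
    rw [LinearMap.comp_apply, LinearMap.neg_apply, LinearMap.comp_apply] at h
    rw [h, hx, map_zero, neg_zero]
  funext I
  have hcocycle : ∀ i : Fin m, coboundary k (fullSubcomplex K I)
      (cochainRestrict (fullSubcomplex_mono K (Finset.subset_insert i I))
        (cochainSign k _ (x (insert i I)))) = 0 := fun i => by
    rw [coboundary_restrict, coboundary_sign,
      show coboundary k _ (x (insert i I)) = 0 from congrFun hx _, map_zero, neg_zero, map_zero]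
  -- Classes are defined only for cocycles. Each summand of `d' x` at `I` is itself a cocycle, so
  -- the sum can be formed inside the kernel before passing to the quotient.
  have hsum : (⟨totalCochainD' k K x I, congrFun hd I⟩ :
      LinearMap.ker (coboundary k (fullSubcomplex K I))) =
      ∑ i ∈ Iᶜ, eps k i (insert i I) • ⟨_, hcocycle i⟩ := by
    refine Subtype.ext ?_
    rw [AddSubmonoidClass.coe_finsetSum]
    simp [totalCochainD']
  change Submodule.mkQ _ (⟨totalCochainD' k K x I, congrFun hd I⟩ :
      LinearMap.ker (coboundary k (fullSubcomplex K I))) = _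
  rw [hsum, map_sum]
  simp only [hochsterD', LinearMap.pi_apply, LinearMap.sum_apply]
  rfl

theorem map_hochsterMap_part (p : ℤ × ℤ) :
    (Cohomology.part _ (cochainBicomplex k K).d_comp_d ((cochainBicomplex k K).gr p)).map
      (hochsterMap k K) = hochsterCohomologyGr k K p := by
  refine le_antisymm ?_ ?_
  · rintro _ ⟨c, hc, rfl⟩ I -
    obtain ⟨(x : TotalCochain k K), (hxG : x ∈ totalCochainGr k K p),
      (hx : totalCochainD k K x = 0), rfl⟩ := Cohomology.exists_of_mem_part hc
    have hxI := hxG I trivial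
    simp only [SetLike.mem_coe] at hxI ⊢
    rw [hochsterMap_mk k K x hx]
    split_ifs at hxI ⊢ with h
    · exact Cohomology.mk_mem_part _ hxI
    -- When `2 * #I` is not the second degree, the component of `x` at `I` is zero, and so is its
    -- class.
    · exact Cohomology.mk_eq_zero.2 ⟨0, by rw [map_zero]; exact hxI.symm⟩
  · intro c hc
    have h : ∀ I, ∃ x : Cochain k (fullSubcomplex K I),
        (x ∈ if p.2 = 2 * (I.card : ℤ) then
          cochainDegree k (fullSubcomplex K I) (p.1 + I.card - 1) else ⊥) ∧
        ∃ hx, Cohomology.mk (coboundary_comp k (fullSubcomplex K I)) x hx = c I := by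
      intro I
      have hcI := hc I trivial
      simp only at hcI
      split_ifs at hcI ⊢ with h
      · exact Cohomology.exists_of_mem_part hcI
      -- For `I` of the wrong size the representative has to be `0` itself, since an arbitrary
      -- coboundary would leave the graded component.
      · refine ⟨0, zero_mem _, map_zero _, ?_⟩
        rw [show c I = 0 from hcI]
        exact Cohomology.mk_eq_zero.2 ⟨0, map_zero _⟩
    choose x hxG hx hxc using h
    exact ⟨Cohomology.mk _ x (funext hx), Cohomology.mk_mem_part _ fun I _ => hxG I, funext hxc⟩

end Hochster

/-! ### The signs `∏ j ∈ L, ε(j, I)` -/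

section CochainToKoszul

variable {m : ℕ} (k : Type) [CommRing k] (K : PreAbstractSimplicialComplex (Fin m))

theorem eps_mul_self (j : Fin m) (I : Finset (Fin m)) : eps k j I * eps k j I = 1 := by
  rw [eps, ← mul_pow]
  simp

theorem eps_union {I J : Finset (Fin m)} (h : Disjoint I J) (j : Fin m) :
    eps k j (I ∪ J) = eps k j I * eps k j J := by
  rw [eps, Finset.filter_union, Finset.card_union_of_disjoint, pow_add]
  · rfl
  · exact Finset.disjoint_filter_filter h

theorem eps_eq_mul_eps_sdiff {L I : Finset (Fin m)} (h : L ⊆ I) (j : Fin m) :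
    eps k j I = eps k j L * eps k j (I \ L) := by
  rw [← eps_union k Finset.disjoint_sdiff, Finset.union_sdiff_of_subset h]

/-- The sign `∏ j ∈ L, ε(j, I)`. -/
def epsProd (L I : Finset (Fin m)) : k := ∏ j ∈ L, eps k j I

theorem epsProd_mul_self (L I : Finset (Fin m)) : epsProd k L I * epsProd k L I = 1 := by
  rw [epsProd, ← Finset.prod_mul_distrib]
  exact Finset.prod_eq_one fun j _ => eps_mul_self k j I

theorem epsProd_insert {j : Fin m} {L : Finset (Fin m)} (hj : j ∉ L) (I : Finset (Fin m)) :
    epsProd k (insert j L) I = eps k j I * epsProd k L I :=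
  Finset.prod_insert hj

/-- Inserting `i` flips `ε(j, I)` exactly for the `j > i`. The number of such `j ∈ L` is `#L` minus
the number of `j ∈ L` below `i`, which gives `(-1) ^ #L * ε(i, L)`. -/
theorem epsProd_insert_right {i : Fin m} {L I : Finset (Fin m)} (hi : i ∉ I) (hL : i ∉ L) :
    epsProd k L (insert i I) = (-1) ^ L.card * eps k i L * epsProd k L I := by
  -- The flip for `j > i` is written as `-1` for every `j`, corrected by another `-1` when `j < i`.
  -- The product over `L` then separates into the two required factors.
  have h : ∀ j ∈ L, eps k j (insert i I) = (-1) * (if j < i then -1 else 1) * eps k j I := by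
    intro j hj
    rw [eps_insert hi]
    have hne : j ≠ i := fun h => hL (h ▸ hj)
    rcases lt_or_gt_of_ne hne with h | h
    · rw [if_pos h, if_neg h.not_gt]; ring
    · rw [if_neg h.not_gt, if_pos h]; ring
  rw [epsProd, Finset.prod_congr rfl h, Finset.prod_mul_distrib, Finset.prod_mul_distrib,
    Finset.prod_const, Finset.prod_ite, Finset.prod_const_one, mul_one, Finset.prod_const]
  rfl

theorem isSimplex_fullSubcomplex {I L : Finset (Fin m)} :
    IsSimplex (fullSubcomplex K I) L ↔ IsSimplex K L ∧ L ⊆ I := by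
  constructor
  · rintro (rfl | h)
    · exact ⟨Or.inl rfl, Finset.empty_subset _⟩
    · exact ⟨Or.inr h.1, h.2⟩
  · rintro ⟨rfl | h, hL⟩
    · exact Or.inl rfl
    · exact Or.inr ⟨h, hL⟩

/-! ### The basis of indicator cochains and the two differentials on it -/

/-- The cochain in `C^*(K_I)` with value `1` on the simplex `L` and `0` on the other simplices; it
vanishes if `L` is not a simplex of `K_I`. -/
def indicatorCochain (I L : Finset (Fin m)) : TotalCochain k K :=
  fun I' L' => if I' = I ∧ L'.1 = L then 1 else 0

/-- This convention matches `v_L = 0` in the face ring for `L ∉ K`, so the formulas for the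
differentials need no side condition on `L ∪ {j}`. -/
theorem indicatorCochain_eq_zero {I L : Finset (Fin m)} (h : ¬ IsSimplex K L) :
    indicatorCochain k K I L = 0 := by
  funext I' L'
  refine if_neg ?_
  rintro ⟨-, rfl⟩
  exact h ((isSimplex_fullSubcomplex K).1 L'.2).1

/-- At a simplex `M` of `K_I` a term survives only for a vertex `j` with `M \ {j} = L`, that is, `M
= L ∪ {j}` with `j ∉ L`. -/
theorem totalCochainD_indicatorCochain {I L : Finset (Fin m)} (hL : L ⊆ I) :
    totalCochainD k K (indicatorCochain k K I L) =
      ∑ j ∈ I \ L, eps k j L • indicatorCochain k K I (insert j L) := by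
  funext I' M
  simp only [Finset.sum_apply, Pi.smul_apply, smul_eq_mul, indicatorCochain]
  change ∑ j ∈ M.1, eps k j (M.1.erase j) * (if I' = I ∧ M.1.erase j = L then 1 else 0) = _
  by_cases hI : I' = I
  · subst hI
    simp only [true_and, mul_ite, mul_one, mul_zero, ← Finset.sum_filter]
    have hM := ((isSimplex_fullSubcomplex K).1 M.2).2
    refine Finset.sum_congr ?_ ?_
    · ext j
      simp only [Finset.mem_filter, Finset.mem_sdiff]
      constructor
      · rintro ⟨hj, rfl⟩
        exact ⟨⟨hM hj, by simp⟩, (Finset.insert_erase hj).symm⟩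
      · rintro ⟨⟨_, hj⟩, h⟩
        rw [h]
        exact ⟨by simp, Finset.erase_insert hj⟩
    · intro j hj
      obtain ⟨h, h'⟩ := Finset.mem_filter.1 hj
      rw [h', Finset.erase_insert (Finset.mem_sdiff.1 h).2]
  · simp [hI]

/-- The value at `(I', M)` is nonzero only if `M = L` and `I' ∪ {i} = I` with `i ∉ I'`. Since `L = M
⊆ I'`, only indices `i ∉ L` contribute: restriction to `K_(I \ {i})` kills a simplex containing `i`.
-/
theorem totalCochainD'_indicatorCochain {I L : Finset (Fin m)} (hL : L ⊆ I) :
    totalCochainD' k K (indicatorCochain k K I L) =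
      ∑ i ∈ I \ L, (eps k i I * (-1) ^ L.card) • indicatorCochain k K (I.erase i) L := by
  funext I' M
  rw [totalCochainD'_apply]
  simp only [Finset.sum_apply, Pi.smul_apply, smul_eq_mul, indicatorCochain]
  by_cases hM : M.1 = L
  · have hMI := ((isSimplex_fullSubcomplex K).1 M.2).2
    rw [hM] at hMI
    simp only [hM, and_true, mul_ite, mul_one, mul_zero, ← Finset.sum_filter]
    refine Finset.sum_congr ?_ ?_
    · ext i
      simp only [Finset.mem_filter, Finset.mem_sdiff, Finset.mem_compl]
      constructor
      · rintro ⟨hi, rfl⟩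
        exact ⟨⟨by simp, fun h => hi (hMI h)⟩, (Finset.erase_insert hi).symm⟩
      · rintro ⟨⟨hi, _⟩, h⟩
        rw [h]
        exact ⟨by simp, Finset.insert_erase hi⟩
    · intro i hi
      obtain ⟨h, h'⟩ := Finset.mem_filter.1 hi
      rw [h', Finset.insert_erase (Finset.mem_sdiff.1 h).1]
  · simp [hM]

/-- The basis of `⊕_I C^*(K_I)` formed by the indicator cochains. -/
noncomputable def cochainBasis :
    Module.Basis ((I : Finset (Fin m)) × {L // IsSimplex (fullSubcomplex K I) L}) k
      (TotalCochain k K) := by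
  classical
  exact Pi.basis fun I => Pi.basisFun k {L // IsSimplex (fullSubcomplex K I) L}

theorem cochainBasis_apply (s : (I : Finset (Fin m)) × {L // IsSimplex (fullSubcomplex K I) L}) :
    cochainBasis k K s = indicatorCochain k K s.1 s.2.1 := by
  classical
  obtain ⟨I, L⟩ := s
  rw [cochainBasis, Pi.basis_apply, Pi.basisFun_apply]
  funext I' L'
  rw [indicatorCochain]
  by_cases h : I' = I
  · subst h
    simp [Pi.single_apply, Subtype.ext_iff]
  · simp [h]

/-- A simplex `L` has degree `p = #L - 1`, hence `q = #L`, and its indicator in `C^*(K_I)` has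
bidegree `(#L - #I, 2 * #I)`. -/
theorem totalCochainGr_eq (p : ℤ × ℤ) : totalCochainGr k K p = Submodule.span k
    (cochainBasis k K '' {s | ((s.2.1.card - s.1.card, 2 * s.1.card) : ℤ × ℤ) = p}) := by
  classical
  refine span_image_eq_of_mem_iff _ _ _ fun x => ?_
  simp only [totalCochainGr, Submodule.mem_pi, Set.mem_univ, true_implies, Sigma.forall,
    cochainBasis, Pi.basis_repr, Pi.basisFun_repr, Set.mem_ofPred_eq]
  refine forall_congr' fun I => ?_
  split_ifs with h
  · refine forall_congr' fun L => imp_congr_left ?_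
    rw [not_iff_not, Prod.ext_iff]
    constructor
    · intro h'; exact ⟨by simp only; omega, h.symm⟩
    · rintro ⟨h', -⟩; simp only at h'; omega
  -- No basis element over this `I` has bidegree `p`, so the condition on coordinates forces the
  -- whole component at `I` to vanish.
  · rw [Submodule.mem_bot]
    constructor
    · intro h0 L _; rw [h0]; rfl
    · intro h0; funext L
      refine h0 L fun h' => h ?_
      rw [← h']

/-! ### The map to the Koszul algebra and its compatibility with both differentials -/

/-- The map from `⊕_I C^*(K_I)` to the Koszul algebra that takes the indicator cochain of a
simplex `L` of `K_I` to `(∏ j ∈ L, ε(j, I)) u_(I \ L) v_L`. -/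
noncomputable def cochainToKoszul : TotalCochain k K →ₗ[k] Koszul k K :=
  (cochainBasis k K).constr k fun s =>
    epsProd k s.2.1 s.1 • koszulMonomial k K (s.1 \ s.2.1) (sqfree s.2.1)

theorem cochainToKoszul_indicatorCochain {I L : Finset (Fin m)} (hL : L ⊆ I) :
    cochainToKoszul k K (indicatorCochain k K I L) =
      epsProd k L I • koszulMonomial k K (I \ L) (sqfree L) := by
  by_cases h : IsSimplex K L
  · have := (cochainBasis k K).constr_basis k (fun s =>
      epsProd k s.2.1 s.1 • koszulMonomial k K (s.1 \ s.2.1) (sqfree s.2.1))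
      ⟨I, L, (isSimplex_fullSubcomplex K).2 ⟨h, hL⟩⟩
    rwa [cochainBasis_apply] at this
  · rw [indicatorCochain_eq_zero k K h, map_zero, koszulMonomial, faceMonomial_eq_zero k K,
      TensorProduct.tmul_zero, smul_zero]
    rwa [sqfree_support]

/-- On basis elements the terms match by index `j ∈ I \ L`. The signs agree because `ε(j, I) = ε(j,
L) ε(j, I \ L)` and `ε(j, L)` squares to `1`. -/
theorem cochainToKoszul_d (x : TotalCochain k K) :
    koszulD k K (cochainToKoszul k K x) = cochainToKoszul k K (totalCochainD k K x) := by
  suffices h : koszulD k K ∘ₗ cochainToKoszul k K = cochainToKoszul k K ∘ₗ totalCochainD k K from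
    LinearMap.congr_fun h x
  refine (cochainBasis k K).ext fun ⟨I, L, hL⟩ => ?_
  have hLI := ((isSimplex_fullSubcomplex K).1 hL).2
  rw [LinearMap.comp_apply, LinearMap.comp_apply, cochainBasis_apply,
    cochainToKoszul_indicatorCochain k K hLI, totalCochainD_indicatorCochain k K hLI, map_smul,
    koszulD_monomial, map_sum, Finset.smul_sum]
  refine Finset.sum_congr rfl fun j hj => ?_
  obtain ⟨hjI, hjL⟩ := Finset.mem_sdiff.1 hj
  have hsq : sqfree (insert j L) = Finsupp.single j 1 + sqfree L := Finset.sum_insert hjL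
  rw [map_smul, cochainToKoszul_indicatorCochain k K (Finset.insert_subset hjI hLI), smul_smul,
    smul_smul, hsq, Finset.sdiff_insert, epsProd_insert k hjL, eps_eq_mul_eps_sdiff k hLI j]
  congr 1
  linear_combination (-(epsProd k L I * eps k j (I \ L))) * eps_mul_self k j L

/-- The terms match by index `i ∈ I \ L`. This is where the factor `(-1) ^ (p + 1) = (-1) ^ #L` is
needed: it comes from comparing the sign products over `I` and `I \ {i}`. -/
theorem cochainToKoszul_d' (x : TotalCochain k K) :
    koszulD' k K (cochainToKoszul k K x) = cochainToKoszul k K (totalCochainD' k K x) := by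
  suffices h : koszulD' k K ∘ₗ cochainToKoszul k K = cochainToKoszul k K ∘ₗ totalCochainD' k K from
    LinearMap.congr_fun h x
  refine (cochainBasis k K).ext fun ⟨I, L, hL⟩ => ?_
  have hLI := ((isSimplex_fullSubcomplex K).1 hL).2
  rw [LinearMap.comp_apply, LinearMap.comp_apply, cochainBasis_apply,
    cochainToKoszul_indicatorCochain k K hLI, totalCochainD'_indicatorCochain k K hLI, map_smul,
    koszulD'_monomial, map_sum, Finset.smul_sum]
  refine Finset.sum_congr rfl fun i hi => ?_
  obtain ⟨hiI, hiL⟩ := Finset.mem_sdiff.1 hi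
  have hI : epsProd k L I = (-1) ^ L.card * eps k i L * epsProd k L (I.erase i) := by
    conv_lhs => rw [← Finset.insert_erase hiI]
    exact epsProd_insert_right k (Finset.notMem_erase i I) hiL
  rw [map_smul, cochainToKoszul_indicatorCochain k K (Finset.subset_erase.2 ⟨hLI, hiL⟩), smul_smul,
    smul_smul, Finset.erase_sdiff_comm, hI, eps_eq_mul_eps_sdiff k hLI i]
  congr 1
  ring

/-! ### Simplices of the `K_I` and the monomials `u_J v_L` with `J ∩ L = ∅` -/

theorem not_badMonomial_iff {J : Finset (Fin m)} {a : Fin m →₀ ℕ} :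
    ¬ BadMonomial J a ↔ Disjoint J a.support ∧ sqfree a.support = a := by
  constructor
  · intro h
    refine ⟨?_, ?_⟩
    · rw [Finset.disjoint_left]
      intro i hi hi'
      have := Finsupp.mem_support_iff.1 hi'
      exact h ⟨i, Or.inr ⟨hi, by omega⟩⟩
    · ext i
      rw [sqfree_apply]
      split_ifs with hi
      · have := Finsupp.mem_support_iff.1 hi
        by_contra h'
        exact h ⟨i, Or.inl (by omega)⟩
      · exact (Finsupp.notMem_support_iff.1 hi).symm
  · rintro ⟨h, h'⟩ ⟨i, hi⟩
    have hs := sqfree_apply a.support i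
    rw [h'] at hs
    rcases hi with hi | ⟨hi, hi'⟩
    · split_ifs at hs <;> omega
    · exact Finset.disjoint_left.1 h hi (Finsupp.mem_support_iff.2 (by omega))

theorem sigma_simplex_ext {s t : (I : Finset (Fin m)) × {L // IsSimplex (fullSubcomplex K I) L}}
    (h1 : s.1 = t.1) (h2 : s.2.1 = t.2.1) : s = t := by
  obtain ⟨I, L, hL⟩ := s
  obtain ⟨J, M, hM⟩ := t
  obtain rfl : I = J := h1
  obtain rfl : L = M := h2
  rfl

/-- The bijection between the simplices `L` of the `K_I` and the monomials
`u_J v_L` with `L ∈ K` and `J ∩ L = ∅`, with `J = I \ L`. -/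
noncomputable def simplexEquivMonomial :
    ((I : Finset (Fin m)) × {L // IsSimplex (fullSubcomplex K I) L}) ≃
      {i : Finset (Fin m) × {a : Fin m →₀ ℕ // IsSimplex K a.support} //
        ¬ BadMonomial i.1 i.2.1} where
  toFun s := ⟨(s.1 \ s.2.1, ⟨sqfree s.2.1, by
      rw [sqfree_support]; exact ((isSimplex_fullSubcomplex K).1 s.2.2).1⟩),
    not_badMonomial_iff.2 ⟨Finset.disjoint_left.2 fun _ h h' =>
      (Finset.mem_sdiff.1 h).2 (sqfree_support s.2.1 ▸ h'),
      congrArg sqfree (sqfree_support s.2.1)⟩⟩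
  invFun i := ⟨i.1.1 ∪ i.1.2.1.support, i.1.2.1.support,
    (isSimplex_fullSubcomplex K).2 ⟨i.1.2.2, Finset.subset_union_right⟩⟩
  left_inv := by
    rintro ⟨I, L, hL⟩
    refine sigma_simplex_ext K ?_ (sqfree_support L)
    change I \ L ∪ (sqfree L).support = I
    rw [sqfree_support]
    exact Finset.sdiff_union_of_subset ((isSimplex_fullSubcomplex K).1 hL).2
  right_inv := by
    rintro ⟨⟨J, a, ha⟩, h⟩
    obtain ⟨h1, h2⟩ := not_badMonomial_iff.1 h
    refine Subtype.ext (Prod.ext ?_ (Subtype.ext h2))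
    exact Finset.union_sdiff_cancel_right h1

/-- The sign `∏ j ∈ L, ε(j, I)` as a unit. -/
def epsProdUnit (L I : Finset (Fin m)) : kˣ :=
  ⟨epsProd k L I, epsProd k L I, epsProd_mul_self k L I, epsProd_mul_self k L I⟩

/-! ### The isomorphism of bicomplexes with `R^*(K)` -/

/-- The isomorphism between `⊕_I C^*(K_I)` and `R^*(K)`. -/
noncomputable def cochainEquivReduced : TotalCochain k K ≃ₗ[k] Reduced k K :=
  (cochainBasis k K).equiv (((reducedBasis k K).reindex (simplexEquivMonomial K).symm).unitsSMul
    fun s => epsProdUnit k s.2.1 s.1) (Equiv.refl _)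

theorem cochainEquivReduced_basis
    (s : (I : Finset (Fin m)) × {L // IsSimplex (fullSubcomplex K I) L}) :
    cochainEquivReduced k K (cochainBasis k K s) =
      epsProdUnit k s.2.1 s.1 • reducedBasis k K (simplexEquivMonomial K s) := by
  rw [cochainEquivReduced, Module.Basis.equiv_apply, Module.Basis.unitsSMul_apply,
    Module.Basis.reindex_apply]
  rfl

/-- Identifying the equivalence of bases with `cochainToKoszul` followed by the quotient map lets
the identities already checked in the Koszul algebra descend to `R^*(K)`. -/
theorem cochainEquivReduced_apply (x : TotalCochain k K) :
    cochainEquivReduced k K x = Submodule.Quotient.mk (cochainToKoszul k K x) := by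
  suffices h : (cochainEquivReduced k K).toLinearMap =
      Submodule.mkQ (reducedIdealSubmodule k K) ∘ₗ cochainToKoszul k K from
    LinearMap.congr_fun h x
  refine (cochainBasis k K).ext fun s => ?_
  rw [LinearEquiv.coe_coe, cochainEquivReduced_basis, reducedBasis_apply, koszulBasis_apply,
    LinearMap.comp_apply, cochainBasis_apply,
    cochainToKoszul_indicatorCochain k K ((isSimplex_fullSubcomplex K).1 s.2.2).2, map_smul]
  rfl

theorem cochainToKoszul_mem (x : TotalCochain k K) :
    cochainToKoszul k K x ∈ disjointSubmodule k K := by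
  suffices h : ⊤ ≤ (disjointSubmodule k K).comap (cochainToKoszul k K) from h trivial
  rw [← (cochainBasis k K).span_eq, Submodule.span_le]
  rintro _ ⟨s, rfl⟩
  change cochainToKoszul k K _ ∈ disjointSubmodule k K
  rw [cochainBasis_apply,
    cochainToKoszul_indicatorCochain k K ((isSimplex_fullSubcomplex K).1 s.2.2).2]
  refine Submodule.smul_mem _ _ (Submodule.subset_span 
    ⟨s.1 \ s.2.1, s.2.1, Finset.sdiff_disjoint, ?_⟩)
  rw [prod_faceVar]
  rfl

theorem eq_of_mk_eq {x y : Koszul k K} (hx : x ∈ disjointSubmodule k K)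
    (hy : y ∈ disjointSubmodule k K)
    (h : (Submodule.Quotient.mk x : Reduced k K) = Submodule.Quotient.mk y) : x = y := by
  have hxy := (Submodule.Quotient.eq _).1 h
  exact sub_eq_zero.1 ((Submodule.disjoint_def.1 (reduced_isCompl k K).disjoint) _ hxy
    (sub_mem hx hy))

theorem cochainToKoszul_injective : Function.Injective (cochainToKoszul k K) := fun x y h =>
  (cochainEquivReduced k K).injective (by
    rw [cochainEquivReduced_apply, cochainEquivReduced_apply, h])

/-- With `J = I \ L`, the monomial `u_J v_L` has `#I - #L` exterior factors and `#I` factors in all.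
-/
theorem bidegree_simplexEquivMonomial
    (s : (I : Finset (Fin m)) × {L // IsSimplex (fullSubcomplex K I) L}) :
    (-((simplexEquivMonomial K s).1.1.card : ℤ), 2 * (((simplexEquivMonomial K s).1.1.card : ℤ) +
      (simplexEquivMonomial K s).1.2.1.degree)) =
      ((s.2.1.card - s.1.card, 2 * s.1.card) : ℤ × ℤ) := by
  have h := Finset.card_sdiff_add_card_eq_card ((isSimplex_fullSubcomplex K).1 s.2.2).2
  have hd : (sqfree s.2.1).degree = s.2.1.card := by simp [sqfree]
  change (-((s.1 \ s.2.1).card : ℤ), 2 * (((s.1 \ s.2.1).card : ℤ) + (sqfree s.2.1).degree)) = _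
  rw [hd]
  ext <;> simp only <;> omega

theorem map_cochainEquivReduced_gr (p : ℤ × ℤ) :
    (totalCochainGr k K p).map (cochainEquivReduced k K).toLinearMap = reducedGr k K p := by
  rw [totalCochainGr_eq, reducedGr_eq, Submodule.map_span]
  refine le_antisymm (Submodule.span_le.2 ?_) (Submodule.span_le.2 ?_)
  · rintro _ ⟨_, ⟨s, rfl, rfl⟩, rfl⟩
    rw [LinearEquiv.coe_coe, cochainEquivReduced_basis]
    exact Submodule.smul_mem _ (epsProd k s.2.1 s.1)
      (Submodule.subset_span ⟨_, bidegree_simplexEquivMonomial K s, rfl⟩)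
  · rintro _ ⟨i, rfl, rfl⟩
    obtain ⟨s, rfl⟩ := (simplexEquivMonomial K).surjective i
    have h := cochainEquivReduced_basis k K s
    -- The sign is a unit, so the monomial itself is a multiple of the image of a cochain of the
    -- same bidegree.
    rw [← inv_smul_eq_iff] at h
    rw [← h]
    exact Submodule.smul_mem _ ((epsProdUnit k s.2.1 s.1)⁻¹ : kˣ).1
      (Submodule.subset_span ⟨_, ⟨s, (bidegree_simplexEquivMonomial K s).symm, rfl⟩, rfl⟩)

theorem cochainEquivReduced_d (x : TotalCochain k K) :
    cochainEquivReduced k K (totalCochainD k K x) = reducedD k K (cochainEquivReduced k K x) := by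
  rw [cochainEquivReduced_apply, cochainEquivReduced_apply, ← cochainToKoszul_d]
  rfl

/-- The ideal of relations is not `d'`-stable in general, since `d'(u_i v_i) = v_i`. So `d'` of a
class must be computed on its representative without repeated indices, and `cochainToKoszul` takes
values among these. -/
theorem cochainEquivReduced_d' (x : TotalCochain k K) :
    cochainEquivReduced k K (totalCochainD' k K x) =
      reducedD' k K (cochainEquivReduced k K x) := by
  rw [cochainEquivReduced_apply, cochainEquivReduced_apply, ← cochainToKoszul_d',
    reducedD'_mk k K _ (cochainToKoszul_mem k K x)]

/-- The isomorphism of bicomplexes between `⊕_I C^*(K_I)` and `R^*(K)`. -/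
noncomputable def cochainIsoReduced :
    Bicomplex.Iso (cochainBicomplex k K) (reducedBicomplex k K) where
  toEquiv := cochainEquivReduced k K
  map_gr := map_cochainEquivReduced_gr k K
  comm_d := cochainEquivReduced_d k K
  comm_d' := cochainEquivReduced_d' k K

theorem cochainToKoszul_gr {p : ℤ × ℤ} {x : TotalCochain k K} (hx : x ∈ totalCochainGr k K p) :
    cochainToKoszul k K x ∈ koszulGr k K p := by
  suffices h : totalCochainGr k K p ≤ (koszulGr k K p).comap (cochainToKoszul k K) from h hx
  rw [totalCochainGr_eq, Submodule.span_le]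
  rintro _ ⟨s, rfl, rfl⟩
  change cochainToKoszul k K _ ∈ koszulGr k K _
  rw [cochainBasis_apply,
    cochainToKoszul_indicatorCochain k K ((isSimplex_fullSubcomplex K).1 s.2.2).2, koszulGr_eq]
  exact Submodule.smul_mem _ _ (Submodule.subset_span
    ⟨_, _, bidegree_simplexEquivMonomial K s, rfl⟩)

/-- The image of `cochainToKoszul` is all of `disjointSubmodule`. The bidegree of the preimage is
read off in `R^*(K)`, where the isomorphism matches graded components exactly. -/
theorem exists_cochainToKoszul_eq {y : Koszul k K} (hy : y ∈ disjointSubmodule k K) :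
    ∃ x, cochainToKoszul k K x = y ∧ ∀ p, y ∈ koszulGr k K p → x ∈ totalCochainGr k K p := by
  obtain ⟨x, hx⟩ := (cochainEquivReduced k K).surjective (Submodule.Quotient.mk y)
  refine ⟨x, eq_of_mk_eq k K (cochainToKoszul_mem k K x) hy ?_, fun p hp => ?_⟩
  · rw [← cochainEquivReduced_apply, hx]
  · have h : (Submodule.Quotient.mk y : Reduced k K) ∈ reducedGr k K p :=
      Submodule.mem_map_of_mem (f := Submodule.mkQ _) hp
    rw [← map_cochainEquivReduced_gr] at h
    obtain ⟨x', hx', h⟩ := h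
    rw [← hx] at h
    rwa [← (cochainEquivReduced k K).injective h]

end CochainToKoszul

/-! ### The contracting homotopy on monomials with a repeated index -/

section KoszulHomotopy

variable {m : ℕ} (k : Type) [CommRing k] (K : PreAbstractSimplicialComplex (Fin m))

/-- The number of the factors `u_i` and `v_i` of the monomial `u_J v^a`. -/
def multidegree (J : Finset (Fin m)) (a : Fin m →₀ ℕ) (i : Fin m) : ℕ :=
  a i + if i ∈ J then 1 else 0

/-- Every term of `d(u_J v^a)` thus has the same first repeated index as `u_J v^a`, so the homotopy
treats all of them with one and the same `i`. -/
theorem multidegree_erase_add {J : Finset (Fin m)} (a : Fin m →₀ ℕ) {j : Fin m} (hj : j ∈ J) :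
    multidegree (J.erase j) (Finsupp.single j 1 + a) = multidegree J a := by
  funext i
  simp only [multidegree, Finsupp.add_apply, Finsupp.single_apply, Finset.mem_erase]
  by_cases h : j = i
  · subst h
    simp [hj, add_comm]
  · simp [h, Ne.symm h]

theorem badMonomial_iff {J : Finset (Fin m)} {a : Fin m →₀ ℕ} :
    BadMonomial J a ↔ ∃ i, 2 ≤ multidegree J a i := by
  refine exists_congr fun i => ?_
  rw [multidegree]
  split_ifs with h
  · simp only [h, true_and]; omega
  · simp [h]

/-- The index `i` is the first one at which the multidegree `b` is at least `2`. -/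
def IsFirstRepeated (b : Fin m → ℕ) (i : Fin m) : Prop := IsLeast {i | 2 ≤ b i} i

theorem exists_isFirstRepeated {J : Finset (Fin m)} {a : Fin m →₀ ℕ} (h : BadMonomial J a) :
    ∃ i, IsFirstRepeated (multidegree J a) i :=
  ⟨_, WellFounded.min_mem wellFounded_lt _ (badMonomial_iff.1 h),
    fun _ hj => WellFounded.min_le wellFounded_lt hj⟩

open Classical in
/-- The contracting homotopy on the span of the monomials `u_J v^a` with a factor `v_i ^ 2` or
`u_i v_i`: for the first such `i`, it exchanges a factor `v_i` for `u_i`. It vanishes on the other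
monomials. -/
noncomputable def koszulHomotopy : Koszul k K →ₗ[k] Koszul k K :=
  (koszulBasis k K).constr k fun s =>
    if h : ∃ i, IsFirstRepeated (multidegree s.1 s.2.1) i then
      if h.choose ∈ s.1 then 0 else eps k h.choose s.1 •
        koszulMonomial k K (insert h.choose s.1) (s.2.1 - Finsupp.single h.choose 1)
    else 0

variable {k K}

theorem koszulMonomial_eq_zero (J : Finset (Fin m)) {a : Fin m →₀ ℕ}
    (h : ¬ IsSimplex K a.support) : koszulMonomial k K J a = 0 := by
  rw [koszulMonomial, faceMonomial_eq_zero k K h, TensorProduct.tmul_zero]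

theorem koszulHomotopy_of_mem {J : Finset (Fin m)} {a : Fin m →₀ ℕ} {i : Fin m}
    (h : IsFirstRepeated (multidegree J a) i) (hi : i ∈ J) :
    koszulHomotopy k K (koszulMonomial k K J a) = 0 := by
  by_cases ha : IsSimplex K a.support
  · have h' : ∃ i, IsFirstRepeated (multidegree J a) i := ⟨i, h⟩
    rw [← koszulBasis_apply k K (J, ⟨a, ha⟩), koszulHomotopy, Module.Basis.constr_basis,
      dif_pos h', if_pos]
    rwa [h'.choose_spec.unique h]
  · rw [koszulMonomial_eq_zero J ha, map_zero]

theorem koszulHomotopy_of_notMem {J : Finset (Fin m)} {a : Fin m →₀ ℕ} {i : Fin m}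
    (h : IsFirstRepeated (multidegree J a) i) (hi : i ∉ J) :
    koszulHomotopy k K (koszulMonomial k K J a) =
      eps k i J • koszulMonomial k K (insert i J) (a - Finsupp.single i 1) := by
  by_cases ha : IsSimplex K a.support
  · have h' : ∃ i, IsFirstRepeated (multidegree J a) i := ⟨i, h⟩
    have hc : h'.choose = i := h'.choose_spec.unique h
    rw [← koszulBasis_apply k K (J, ⟨a, ha⟩), koszulHomotopy, Module.Basis.constr_basis,
      dif_pos h', hc, if_neg hi]
  · rw [koszulMonomial_eq_zero J ha, map_zero, koszulMonomial_eq_zero, smul_zero]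
    -- As `i ∉ J`, this says `a i ≥ 2`. Lowering the exponent by one keeps the support, so a
    -- monomial that vanishes in the face ring still vanishes after the exchange. With exponent `1`
    -- this would fail.
    have h2 : 2 ≤ multidegree J a i := h.1
    rw [multidegree, if_neg hi] at h2
    refine fun h' => ha (h'.mono fun j hj => ?_)
    rw [Finsupp.mem_support_iff] at hj ⊢
    rw [Finsupp.tsub_apply, Finsupp.single_apply]
    split_ifs with hij
    · subst hij; omega
    · omega

theorem koszulHomotopy_of_not_bad {J : Finset (Fin m)} {a : Fin m →₀ ℕ}
    (h : ¬ BadMonomial J a) : koszulHomotopy k K (koszulMonomial k K J a) = 0 := by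
  by_cases ha : IsSimplex K a.support
  · rw [← koszulBasis_apply k K (J, ⟨a, ha⟩), koszulHomotopy, Module.Basis.constr_basis,
      dif_neg fun ⟨i, hi⟩ => h (badMonomial_iff.2 ⟨i, hi.1⟩)]
  · rw [koszulMonomial_eq_zero J ha, map_zero]

/-- Let `i` be the first repeated index. If `i ∈ J`, the homotopy `s` kills the monomial, and `sd`
returns it through the term that turns `u_i` into `v_i` and back. If `i ∉ J`, the term of `ds` at
`i` returns the monomial, and the terms at `j ∈ J` cancel against those of `sd`. -/
theorem koszulHomotopy_bad {J : Finset (Fin m)} {a : Fin m →₀ ℕ} (h : BadMonomial J a) :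
    koszulD k K (koszulHomotopy k K (koszulMonomial k K J a)) +
      koszulHomotopy k K (koszulD k K (koszulMonomial k K J a)) = koszulMonomial k K J a := by
  obtain ⟨i, hi⟩ := exists_isFirstRepeated h
  have hd : ∀ j ∈ J, IsFirstRepeated
      (multidegree (J.erase j) (Finsupp.single j 1 + a)) i := fun j hj => by
    rwa [multidegree_erase_add a hj]
  have h2 : 2 ≤ multidegree J a i := hi.1
  rw [koszulD_monomial, map_sum]
  by_cases hJ : i ∈ J
  · rw [koszulHomotopy_of_mem hi hJ, map_zero, zero_add, Finset.sum_eq_single_of_mem i hJ]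
    · rw [map_smul, koszulHomotopy_of_notMem (hd i hJ) (Finset.notMem_erase i J),
        Finset.insert_erase hJ, add_tsub_cancel_left, smul_smul, eps_erase_self, eps_mul_self,
        one_smul]
    · intro j hj hji
      -- The other terms of `d` still contain `u_i`, so the homotopy kills them.
      rw [map_smul, koszulHomotopy_of_mem (hd j hj) (Finset.mem_erase.2 ⟨hji.symm, hJ⟩), smul_zero]
  · rw [multidegree, if_neg hJ] at h2
    have hle : Finsupp.single i 1 ≤ a := by
      rw [Finsupp.single_le_iff]; omega
    rw [koszulHomotopy_of_notMem hi hJ, map_smul, koszulD_monomial, Finset.sum_insert hJ,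
      Finset.erase_insert hJ, add_tsub_cancel_of_le hle, smul_add, smul_smul, eps_insert_self,
      eps_mul_self, one_smul, add_assoc, Finset.smul_sum, ← Finset.sum_add_distrib]
    refine add_eq_left.2 (Finset.sum_eq_zero fun j hj => ?_)
    have hij : i ≠ j := fun h => hJ (h ▸ hj)
    have hJ' : i ∉ J.erase j := fun h => hJ (Finset.mem_of_mem_erase h)
    rw [map_smul, koszulHomotopy_of_notMem (hd j hj) hJ', smul_smul, smul_smul,
      Finset.erase_insert_of_ne hij, add_tsub_assoc_of_le hle, ← add_smul]
    have hs := eps_insert_mul (k := k) hJ' (Finset.notMem_erase j J) hij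
    rw [Finset.insert_erase hj] at hs
    have e1 : eps k j (insert i (J.erase j)) = eps k j (insert i J) := by
      rw [← Finset.erase_insert_of_ne hij, eps_erase_self]
    rw [e1, eps_erase_self] at hs
    -- Multiply the anticommutation relation `hs` by `ε(i, J) ε(i, J \ {j})` and use that signs
    -- square to `1`.
    have h0 : eps k i J * eps k j (insert i J) + eps k j J * eps k i (J.erase j) = 0 := by
      linear_combination (eps k i J * eps k i (J.erase j)) * hs -
        (eps k i J * eps k j (insert i J)) * eps_mul_self k i (J.erase j) -
        (eps k j J * eps k i (J.erase j)) * eps_mul_self k i J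
    rw [h0, zero_smul]

/-- The terms of `d` have the same multidegree, hence no repeated index either, and the homotopy
vanishes on all of them. -/
theorem koszulHomotopy_not_bad {J : Finset (Fin m)} {a : Fin m →₀ ℕ} (h : ¬ BadMonomial J a) :
    koszulD k K (koszulHomotopy k K (koszulMonomial k K J a)) +
      koszulHomotopy k K (koszulD k K (koszulMonomial k K J a)) = 0 := by
  rw [koszulHomotopy_of_not_bad h, map_zero, zero_add, koszulD_monomial, map_sum]
  refine Finset.sum_eq_zero fun j hj => ?_
  rw [map_smul, koszulHomotopy_of_not_bad, smul_zero]
  rwa [badMonomial_iff, multidegree_erase_add a hj, ← badMonomial_iff]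

/-- Exchanging `v_i` for `u_i` adds one exterior factor and keeps the total number of factors. -/
theorem koszulHomotopy_mem_koszulGr {p : ℤ × ℤ} {x : Koszul k K} (hx : x ∈ koszulGr k K p) :
    koszulHomotopy k K x ∈ koszulGr k K (p - (1, 0)) := by
  suffices h : koszulGr k K p ≤ (koszulGr k K (p - (1, 0))).comap (koszulHomotopy k K) from h hx
  rw [koszulGr_eq, monomialSpan, Submodule.span_le]
  rintro _ ⟨J, a, rfl, rfl⟩
  change koszulHomotopy k K _ ∈ koszulGr k K _
  by_cases hb : BadMonomial J a
  · obtain ⟨i, hi⟩ := exists_isFirstRepeated hb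
    by_cases hJ : i ∈ J
    · rw [koszulHomotopy_of_mem hi hJ]
      exact zero_mem _
    · have h2 : 2 ≤ multidegree J a i := hi.1
      rw [multidegree, if_neg hJ] at h2
      have hle : Finsupp.single i 1 ≤ a := by
        rw [Finsupp.single_le_iff]; omega
      have hdeg := congrArg Finsupp.degree (add_tsub_cancel_of_le hle)
      rw [map_add, Finsupp.degree_single] at hdeg
      rw [koszulHomotopy_of_notMem hi hJ, koszulGr_eq]
      refine Submodule.smul_mem _ _ (Submodule.subset_span ⟨_, _, ?_, rfl⟩)
      have hcard := Finset.card_insert_of_notMem hJ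
      ext <;> simp only [Prod.fst_sub, Prod.snd_sub] <;> omega
  · rw [koszulHomotopy_of_not_bad hb]
    exact zero_mem _

/-! ### The chain projection onto the span of the `u_J v_I` with `J ∩ I = ∅` -/

variable (k K)

/-- The projection `1 - (d s + s d)` of the Koszul algebra onto the span of the `u_J v_I` with
`J ∩ I = ∅`, where `s` is the homotopy. -/
noncomputable def disjointProjection : Koszul k K →ₗ[k] Koszul k K :=
  LinearMap.id - (koszulD k K ∘ₗ koszulHomotopy k K + koszulHomotopy k K ∘ₗ koszulD k K)

variable {k K}

theorem disjointProjection_apply (x : Koszul k K) : disjointProjection k K x =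
    x - (koszulD k K (koszulHomotopy k K x) + koszulHomotopy k K (koszulD k K x)) :=
  rfl

theorem koszulD_koszulD (x : Koszul k K) : koszulD k K (koszulD k K x) = 0 :=
  LinearMap.congr_fun (koszulBicomplex k K).d_comp_d x

theorem koszulD_disjointProjection (x : Koszul k K) :
    koszulD k K (disjointProjection k K x) = disjointProjection k K (koszulD k K x) := by
  rw [disjointProjection_apply, disjointProjection_apply, koszulD_koszulD, map_sub, map_add,
    koszulD_koszulD, map_zero, zero_add, add_zero]

theorem disjointProjection_mem (x : Koszul k K) :
    disjointProjection k K x ∈ disjointSubmodule k K := by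
  suffices h : ⊤ ≤ (disjointSubmodule k K).comap (disjointProjection k K) from h trivial
  rw [← (koszulBasis k K).span_eq, Submodule.span_le]
  rintro _ ⟨s, rfl⟩
  change disjointProjection k K _ ∈ disjointSubmodule k K
  rw [koszulBasis_apply, disjointProjection_apply]
  by_cases h : BadMonomial s.1 s.2.1
  · rw [koszulHomotopy_bad h, sub_self]
    exact zero_mem _
  · rw [koszulHomotopy_not_bad h, sub_zero, disjointSubmodule_eq]
    exact Submodule.subset_span ⟨_, _, h, rfl⟩

theorem disjointProjection_of_mem {x : Koszul k K} (hx : x ∈ disjointSubmodule k K) :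
    disjointProjection k K x = x := by
  suffices h : disjointSubmodule k K ≤
      LinearMap.eqLocus (disjointProjection k K) LinearMap.id from h hx
  rw [disjointSubmodule_eq, monomialSpan, Submodule.span_le]
  rintro _ ⟨J, a, h, rfl⟩
  change disjointProjection k K _ = _
  rw [disjointProjection_apply, koszulHomotopy_not_bad h, sub_zero]
  rfl

theorem koszulD_koszulHomotopy_mem {p : ℤ × ℤ} {x : Koszul k K} (hx : x ∈ koszulGr k K p) :
    koszulD k K (koszulHomotopy k K x) ∈ koszulGr k K p := by
  have h := (koszulBicomplex k K).d_mem _ _ (koszulHomotopy_mem_koszulGr hx)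
  rwa [sub_add_cancel] at h

/-! ### The quasi-isomorphism and the induced isomorphism with the Hochster sum -/

variable (k K)

/-- Injectivity on cohomology. The projection commutes with `d` and fixes the image of `x`, so it
moves a bounding element `w` into `disjointSubmodule`, where it comes from a cochain. -/
theorem exists_totalCochainD_eq (x : TotalCochain k K)
    (hx : ∃ w, koszulD k K w = cochainToKoszul k K x) : ∃ z, totalCochainD k K z = x := by
  obtain ⟨w, hw⟩ := hx
  obtain ⟨z, hz, -⟩ := exists_cochainToKoszul_eq k K (disjointProjection_mem w)
  refine ⟨z, cochainToKoszul_injective k K ?_⟩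
  rw [← cochainToKoszul_d, hz, koszulD_disjointProjection, hw,
    disjointProjection_of_mem (cochainToKoszul_mem k K x)]

/-- Surjectivity on cohomology, with control of bidegrees. For a cocycle `y` the projection is `y -
d s y`; it is homologous to `y`, has the same bidegree, and comes from a cochain. -/
theorem exists_cocycle_homologous (y : Koszul k K) (hy : koszulD k K y = 0) :
    ∃ x, totalCochainD k K x = 0 ∧ (∀ p, y ∈ koszulGr k K p → x ∈ totalCochainGr k K p) ∧
      ∃ w, koszulD k K w = y - cochainToKoszul k K x := by
  obtain ⟨x, hx, hxG⟩ := exists_cochainToKoszul_eq k K (disjointProjection_mem y)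
  have hπ : disjointProjection k K y = y - koszulD k K (koszulHomotopy k K y) := by
    rw [disjointProjection_apply, hy, map_zero, add_zero]
  refine ⟨x, cochainToKoszul_injective k K ?_, fun p hp => hxG p ?_, koszulHomotopy k K y, ?_⟩
  · rw [← cochainToKoszul_d, hx, koszulD_disjointProjection, hy, map_zero, map_zero]
  · rw [hπ]
    exact sub_mem hp (koszulD_koszulHomotopy_mem hp)
  · rw [hx, hπ, sub_sub_cancel]

/-- The isomorphism `H(⊕_I C^*(K_I), d) ≅ H(Λ[u_1, …, u_m] ⊗ k[K], d)`. -/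
noncomputable def cochainHEquivKoszulH : (cochainBicomplex k K).H ≃ₗ[k] (koszulBicomplex k K).H :=
  Cohomology.equivOfQuasiIso (cochainToKoszul k K) (cochainToKoszul_d k K)
    (fun x _ => exists_totalCochainD_eq k K x)
    (fun y hy => (exists_cocycle_homologous k K y hy).imp fun _ h => ⟨h.1, h.2.2⟩)

/-- The equivalence is induced by `cochainToKoszul`, which commutes with `d'` on the nose; the
homotopy enters only in its bijectivity. -/
theorem cochainHEquivKoszulH_dH (c : (cochainBicomplex k K).H) :
    cochainHEquivKoszulH k K ((cochainBicomplex k K).dH c) =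
      (koszulBicomplex k K).dH (cochainHEquivKoszulH k K c) := by
  obtain ⟨x, hx, rfl⟩ := Cohomology.exists_mk c
  refine congrArg Submodule.Quotient.mk (Subtype.ext ?_)
  exact (cochainToKoszul_d' k K x).symm

theorem map_cochainHEquivKoszulH_part (p : ℤ × ℤ) :
    (Cohomology.part _ (cochainBicomplex k K).d_comp_d ((cochainBicomplex k K).gr p)).map
      (cochainHEquivKoszulH k K).toLinearMap =
    Cohomology.part _ (koszulBicomplex k K).d_comp_d ((koszulBicomplex k K).gr p) := by
  refine Cohomology.map_part_eq _ (cochainToKoszul k K) (fun x hx => ?_) (fun x hx => rfl)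
    (fun x hx => cochainToKoszul_gr k K hx) fun y hyG hy => ?_
  · exact (cochainToKoszul_d k K x).trans ((congrArg _ hx).trans (map_zero _))
  · obtain ⟨x, hx, hxG, hw⟩ := exists_cocycle_homologous k K y hy
    exact ⟨x, hxG p hyG, hx, hw⟩

/-- The isomorphism `⊕_I H^*(K_I) ≅ H(Λ[u_1, …, u_m] ⊗ k[K], d)`. -/
noncomputable def hochsterEquivKoszulH : HochsterCohomology k K ≃ₗ[k] (koszulBicomplex k K).H :=
  (LinearEquiv.ofBijective _ (hochsterMap_bijective k K)).symm ≪≫ₗ cochainHEquivKoszulH k K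

theorem hochsterEquivKoszulH_hochsterMap (c : (cochainBicomplex k K).H) :
    hochsterEquivKoszulH k K (hochsterMap k K c) = cochainHEquivKoszulH k K c :=
  congrArg (cochainHEquivKoszulH k K)
    ((LinearEquiv.ofBijective _ (hochsterMap_bijective k K)).symm_apply_apply c)

theorem hochsterEquivKoszulH_d' (c : HochsterCohomology k K) :
    (koszulBicomplex k K).dH (hochsterEquivKoszulH k K c) =
      hochsterEquivKoszulH k K (hochsterD' k K c) := by
  obtain ⟨c, rfl⟩ := (hochsterMap_bijective k K).surjective c
  rw [← hochsterMap_dH, hochsterEquivKoszulH_hochsterMap, hochsterEquivKoszulH_hochsterMap,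
    cochainHEquivKoszulH_dH]

theorem map_hochsterEquivKoszulH_gr (p : ℤ × ℤ) :
    (hochsterCohomologyGr k K p).map (hochsterEquivKoszulH k K).toLinearMap =
      Cohomology.part _ (koszulBicomplex k K).d_comp_d ((koszulBicomplex k K).gr p) := by
  rw [← map_hochsterMap_part, ← Submodule.map_comp, ← map_cochainHEquivKoszulH_part]
  congr 1
  exact LinearMap.ext (hochsterEquivKoszulH_hochsterMap k K)

end KoszulHomotopy

/-! ### The theorem -/

theorem theorem4p2 (m : ℕ) (K : PreAbstractSimplicialComplex (Fin m)) :
    Nonempty (Bicomplex.Iso (cochainBicomplex ℤ K) (reducedBicomplex ℤ K)) ∧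
    ∃ e : DoubleCohomology ℤ K ≃ₗ[ℤ] (koszulBicomplex ℤ K).FirstDoubleCohomology,
      ∀ p : ℤ × ℤ, (doubleCohomologyGr ℤ K p).map e.toLinearMap =
        (koszulBicomplex ℤ K).firstDoubleCohomologyGr p := by
  refine ⟨⟨cochainIsoReduced ℤ K⟩, ?_⟩
  -- The first cohomologies are now complexes under `d'`, isomorphic with matching graded parts, so
  -- their cohomologies correspond in each bidegree.
  obtain ⟨E, hE⟩ := Cohomology.exists_equiv (hochsterD'_comp ℤ K)
    (koszulBicomplex ℤ K).dH_comp_dH (hochsterEquivKoszulH ℤ K) (hochsterEquivKoszulH_d' ℤ K)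
  exact ⟨E, fun p => hE _ _ (map_hochsterEquivKoszulH_gr ℤ K p)⟩
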